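/- Let $N$ be a $(2n+1)$-dimensional $C^\infty$ manifold (Hausdorff, second countable) with an almost contact metric structure $(\phi,\xi,\eta,g)$: $g$ is a Riemannian metric, $\phi$ a smooth tensor field of type $(1,1)$, $\xi$ a smooth vector field and $\eta$ a smooth $1$-form with $$\phi^2=-I+\eta\otimes\xi,\qquad \eta(\xi)=1,\qquad g(\phi X,\phi Y)=g(X,Y)-\eta(X)\eta(Y).$$ Suppose that $N$ is cosymplectic: $\eta$ and $\Phi(X,Y):=g(X,\phi Y)$ are closed, and the structure is normal, i.e. for all smooth vector fields $X,Y$ $$\phi^2[X,Y]+[\phi X,\phi Y]-\phi[\phi X,Y]-\phi[X,\phi Y]+2\,d\eta(X,Y)\,\xi=0,$$ where $2\,d\eta(X,Y)=X\eta(Y)-Y\eta(X)-\eta([X,Y])$. Let $M$ be a nonempty compact (Hausdorff, boundaryless) $2m$-dimensional $C^\infty$ manifold and $f:M\to N$ a smooth immersion (so that $M$ is a, possibly self-intersecting, submanifold of $N$; tangent vectors of $M$ are identified with their images under $df$). Put $M_p:=\{X\in T_pM : g(X,\xi)=0\}$. Suppose that $M$ is proper pointwise slant: there is a function $\theta:M\to[0,\pi/2)$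 such that for every $p\in M$ and every nonzero $X\in M_p$ the angle between $\phi X$ and the subspace $M_p$ equals $\theta(p)$. Suppose also that $\xi$ is normal to $M$, i.e. $g(X,\xi)=0$ for all $X\in T_pM$, $p\in M$. For $X\in T_pM$ let $TX$ be the orthogonal projection of $\phi X$ to $T_pM$, and let $\Omega(X,Y):=g(X,TY)$, a $2$-form on $M$. Then: 1. if $m\ge 1$, then $\Omega$ is smooth and closed, and its de Rham class $[\Omega]\in H^2(M,\mathbb R)$ is nonzero; 2. $\dim_{\mathbb R} H^{2i}(M,\mathbb R)\ge 1$ for all $0\le i\le m$. -/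

import Mathlib

open Bundle Set
open scoped Manifold ContDiff

noncomputable section

namespace SlantGeometry

/-! ### Differential forms and de Rham cohomology of a manifold without boundary -/

section DeRham

variable (E : Type*) [NormedAddCommGroup E] [NormedSpace ℝ E]
  (M : Type*) [TopologicalSpace M] [ChartedSpace E M]

/-- A (not necessarily smooth) real differential `k`-form on a manifold `M` modelled on `E`:
an alternating `k`-linear form on every tangent space. -/
def DiffForm (k : ℕ) : Type _ :=
  Π x : M, (TangentSpace 𝓘(ℝ, E) x) [⋀^Fin k]→L[ℝ] ℝ

variable {E M} {k : ℕ}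

instance : AddCommGroup (DiffForm E M k) :=
  inferInstanceAs (AddCommGroup (Π x : M, (TangentSpace 𝓘(ℝ, E) x) [⋀^Fin k]→L[ℝ] ℝ))

instance : Module ℝ (DiffForm E M k) :=
  inferInstanceAs (Module ℝ (Π x : M, (TangentSpace 𝓘(ℝ, E) x) [⋀^Fin k]→L[ℝ] ℝ))

/-- The expression of a form `α` in the preferred chart `e` at `x₀`: the pullback of `α` under
`e.symm`, a form on (the open subset `e.target` of) the model space `E`. -/
def inChart (α : DiffForm E M k) (x₀ : M) : E → E [⋀^Fin k]→L[ℝ] ℝ :=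
  fun y ↦ (α ((extChartAt 𝓘(ℝ, E) x₀).symm y)).compContinuousLinearMap
    (mfderiv 𝓘(ℝ, E) 𝓘(ℝ, E) (extChartAt 𝓘(ℝ, E) x₀).symm y)

/-- A form is smooth if its expressions in charts are smooth. -/
def IsSmoothForm (α : DiffForm E M k) : Prop :=
  ∀ x₀ : M, ContDiffOn ℝ ∞ (inChart α x₀) (extChartAt 𝓘(ℝ, E) x₀).target

/-- The exterior derivative of a form: at the point `x` it is computed in the preferred chart
at `x` and pulled back to `M`. The normalization is
`dα(v₀, …, v_k) = ∑ (-1)^i (D_{v_i} α)(v₀, …, v̂_i, …, v_k)` in charts. -/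
def extD (α : DiffForm E M k) : DiffForm E M (k + 1) :=
  fun x ↦ (extDeriv (inChart α x) (extChartAt 𝓘(ℝ, E) x x)).compContinuousLinearMap
    (mfderiv 𝓘(ℝ, E) 𝓘(ℝ, E) (extChartAt 𝓘(ℝ, E) x) x)

lemma inChart_add (α β : DiffForm E M k) (x₀ : M) :
    inChart (α + β) x₀ = inChart α x₀ + inChart β x₀ := rfl

lemma inChart_smul (c : ℝ) (α : DiffForm E M k) (x₀ : M) :
    inChart (c • α) x₀ = c • inChart α x₀ := rfl

lemma inChart_zero (x₀ : M) : inChart (0 : DiffForm E M k) x₀ = 0 := rfl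

lemma IsSmoothForm.zero : IsSmoothForm (0 : DiffForm E M k) := fun x₀ ↦ by
  rw [inChart_zero]
  exact contDiffOn_const (c := (0 : E [⋀^Fin k]→L[ℝ] ℝ))

lemma IsSmoothForm.add {α β : DiffForm E M k} (hα : IsSmoothForm α) (hβ : IsSmoothForm β) :
    IsSmoothForm (α + β) := fun x₀ ↦ by
  rw [inChart_add]
  exact (hα x₀).add (hβ x₀)

lemma IsSmoothForm.smul (c : ℝ) {α : DiffForm E M k} (hα : IsSmoothForm α) :
    IsSmoothForm (c • α) := fun x₀ ↦ by
  rw [inChart_smul]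
  exact contDiffOn_const.smul (hα x₀)

lemma IsSmoothForm.differentiableAt {α : DiffForm E M k} (hα : IsSmoothForm α) (x : M) :
    DifferentiableAt ℝ (inChart α x) (extChartAt 𝓘(ℝ, E) x x) :=
  ((hα x).contDiffAt ((isOpen_extChartAt_target x).mem_nhds
    (mem_extChartAt_target x))).differentiableAt (by simp)

lemma extD_add {α β : DiffForm E M k} (hα : IsSmoothForm α) (hβ : IsSmoothForm β) :
    extD (α + β) = extD α + extD β := by
  funext x
  simp only [extD, inChart_add]
  rw [extDeriv_add (hα.differentiableAt x) (hβ.differentiableAt x)]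
  rfl

lemma extD_smul (c : ℝ) (α : DiffForm E M k) : extD (c • α) = c • extD α := by
  funext x
  simp only [extD, inChart_smul]
  rw [extDeriv_smul]
  rfl

lemma extD_zero : extD (0 : DiffForm E M k) = 0 := by
  simpa using extD_smul 0 (0 : DiffForm E M k)

variable (E M)

/-- The space of smooth closed `k`-forms. -/
def closedForms (k : ℕ) : Submodule ℝ (DiffForm E M k) where
  carrier := {α | IsSmoothForm α ∧ extD α = 0}
  add_mem' := fun {α β} hα hβ ↦
    ⟨hα.1.add hβ.1, by rw [extD_add hα.1 hβ.1, hα.2, hβ.2, add_zero]⟩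
  zero_mem' := ⟨.zero, extD_zero⟩
  smul_mem' := fun c α hα ↦ ⟨hα.1.smul c, by rw [extD_smul, hα.2, smul_zero]⟩

/-- The space of exact `k`-forms: the exterior derivatives of smooth `(k - 1)`-forms
(only `0` if `k = 0`). -/
def exactForms : (k : ℕ) → Submodule ℝ (DiffForm E M k)
  | 0 => ⊥
  | k + 1 =>
    { carrier := {α | ∃ β : DiffForm E M k, IsSmoothForm β ∧ extD β = α}
      add_mem' := by
        rintro _ _ ⟨α, hα, rfl⟩ ⟨β, hβ, rfl⟩
        exact ⟨α + β, hα.add hβ, extD_add hα hβ⟩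
      zero_mem' := ⟨0, .zero, extD_zero⟩
      smul_mem' := by
        rintro c _ ⟨α, hα, rfl⟩
        exact ⟨c • α, hα.smul c, extD_smul c α⟩ }

/-- The de Rham cohomology `H^k(M, ℝ)`: smooth closed `k`-forms modulo exact ones. -/
abbrev DeRhamCohomology (k : ℕ) : Type _ :=
  closedForms E M k ⧸ (exactForms E M k).submoduleOf (closedForms E M k)

variable {E M}

/-- The de Rham class of a smooth closed form. -/
def deRhamClass (α : DiffForm E M k) (hα : α ∈ closedForms E M k) : DeRhamCohomology E M k :=
  Submodule.Quotient.mk ⟨α, hα⟩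

end DeRham

/-! ### Two-forms on a vector space -/

section TwoForm

variable {V : Type*} [AddCommGroup V] [Module ℝ V] [TopologicalSpace V]

/-- A continuous alternating bilinear form `b`, as the alternating map `v ↦ b (v 0) (v 1)`. -/
def twoForm (b : LinearMap.BilinForm ℝ V) (hb : b.IsAlt)
    (hc : Continuous fun p : V × V ↦ b p.1 p.2) : V [⋀^Fin 2]→L[ℝ] ℝ where
  toFun v := b (v 0) (v 1)
  map_update_add' v i x y := by
    fin_cases i <;> simp
  map_update_smul' v i c x := by
    fin_cases i <;> simp
  map_eq_zero_of_eq' v i j h hij := by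
    have h01 : v 0 = v 1 := by
      fin_cases i <;> fin_cases j <;> simp_all
    rw [h01]
    exact hb _
  cont := by
    have h : Continuous fun v : Fin 2 → V ↦ (v 0, v 1) :=
      (continuous_apply (0 : Fin 2)).prodMk (continuous_apply (1 : Fin 2))
    exact hc.comp h

@[simp] lemma twoForm_apply (b : LinearMap.BilinForm ℝ V) (hb : b.IsAlt)
    (hc : Continuous fun p : V × V ↦ b p.1 p.2) (v : Fin 2 → V) :
    twoForm b hb hc v = b (v 0) (v 1) := rfl

end TwoForm

/-! ### Almost contact metric structures -/

section AlmostContact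

variable (E : Type*) [NormedAddCommGroup E] [NormedSpace ℝ E]
  (N : Type*) [TopologicalSpace N] [ChartedSpace E N] [IsManifold 𝓘(ℝ, E) ∞ N]
  [RiemannianBundle (fun x : N ↦ TangentSpace 𝓘(ℝ, E) x)]

/-- An almost contact metric structure `(φ, ξ, η, g)` on a manifold `N`: the Riemannian metric `g`
is the given one; `φ` is a smooth tensor field of type `(1,1)`, `ξ` a smooth vector field and `η` a
smooth one-form with `φ² = -I + η ⊗ ξ`, `η(ξ) = 1` and `g(φX, φY) = g(X, Y) - η(X)η(Y)`. -/
structure AlmostContactMetricStructure where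
  /-- the tensor field of type `(1,1)` -/
  φ : Π x : N, TangentSpace 𝓘(ℝ, E) x →L[ℝ] TangentSpace 𝓘(ℝ, E) x
  /-- the characteristic vector field -/
  ξ : Π x : N, TangentSpace 𝓘(ℝ, E) x
  /-- the one-form -/
  η : Π x : N, TangentSpace 𝓘(ℝ, E) x →L[ℝ] ℝ
  contMDiff_φ : ContMDiff 𝓘(ℝ, E) (𝓘(ℝ, E).prod 𝓘(ℝ, E →L[ℝ] E)) ∞
    (fun x ↦ TotalSpace.mk' (E →L[ℝ] E)
      (E := fun x : N ↦ TangentSpace 𝓘(ℝ, E) x →L[ℝ] TangentSpace 𝓘(ℝ, E) x) x (φ x))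
  contMDiff_ξ : ContMDiff 𝓘(ℝ, E) 𝓘(ℝ, E).tangent ∞
    (fun x ↦ (⟨x, ξ x⟩ : TangentBundle 𝓘(ℝ, E) N))
  contMDiff_η : ContMDiff 𝓘(ℝ, E) (𝓘(ℝ, E).prod 𝓘(ℝ, E →L[ℝ] ℝ)) ∞
    (fun x ↦ TotalSpace.mk' (E →L[ℝ] ℝ)
      (E := fun x : N ↦ TangentSpace 𝓘(ℝ, E) x →L[ℝ] Trivial N ℝ x) x (η x))
  φ_φ : ∀ (x : N) (v : TangentSpace 𝓘(ℝ, E) x), φ x (φ x v) = -v + η x v • ξ x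
  η_ξ : ∀ x : N, η x (ξ x) = 1
  inner_φ_φ : ∀ (x : N) (u v : TangentSpace 𝓘(ℝ, E) x),
    inner ℝ (φ x u) (φ x v) = inner ℝ u v - η x u * η x v

namespace AlmostContactMetricStructure

variable {E N}
variable (S : AlmostContactMetricStructure E N)

lemma φ_ξ (x : N) : S.φ x (S.ξ x) = 0 := by
  have h := S.inner_φ_φ x (S.φ x (S.ξ x)) (S.φ x (S.ξ x))
  have h0 : S.φ x (S.φ x (S.ξ x)) = 0 := by rw [S.φ_φ, S.η_ξ, one_smul, neg_add_cancel]
  -- `φ ξ` is a multiple of `ξ`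
  have h1 : S.φ x (S.φ x (S.φ x (S.ξ x))) = 0 := by rw [h0, map_zero]
  rw [S.φ_φ] at h1
  have h2 : S.φ x (S.ξ x) = S.η x (S.φ x (S.ξ x)) • S.ξ x := by
    rw [neg_add_eq_zero] at h1; exact h1
  set c := S.η x (S.φ x (S.ξ x)) with hc
  have h3 : c • S.φ x (S.ξ x) = 0 := by rw [← map_smul, ← h2, h0]
  rcases smul_eq_zero.1 h3 with h4 | h4
  · rw [h2, h4, zero_smul]
  · exact h4

lemma η_φ (x : N) (v : TangentSpace 𝓘(ℝ, E) x) : S.η x (S.φ x v) = 0 := by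
  have h1 : S.φ x (S.φ x (S.φ x v)) = -S.φ x v := by
    rw [S.φ_φ x v, map_add, map_neg, map_smul, S.φ_ξ, smul_zero, add_zero]
  have h2 := S.φ_φ x (S.φ x v)
  rw [h1] at h2
  have h3 : S.η x (S.φ x v) • S.ξ x = 0 := by simpa using h2
  have h4 := congrArg (S.η x) h3
  simpa [S.η_ξ] using h4

lemma inner_φ_self (x : N) (v : TangentSpace 𝓘(ℝ, E) x) : inner ℝ v (S.φ x v) = 0 := by
  have hξ : ∀ w : TangentSpace 𝓘(ℝ, E) x, inner ℝ w (S.ξ x) = S.η x w := fun w ↦ by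
    have h := S.inner_φ_φ x w (S.ξ x)
    rw [S.φ_ξ, inner_zero_right, S.η_ξ, mul_one] at h
    linarith
  have h := S.inner_φ_φ x v (S.φ x v)
  rw [S.φ_φ, S.η_φ, mul_zero, sub_zero, inner_add_right, inner_neg_right, inner_smul_right, hξ,
    S.η_φ, mul_zero, add_zero, real_inner_comm] at h
  linarith

/-- The one-form `η` as a differential form. -/
def ηForm : DiffForm E N 1 :=
  fun x ↦ ContinuousAlternatingMap.ofSubsingleton ℝ (TangentSpace 𝓘(ℝ, E) x) ℝ (0 : Fin 1) (S.η x)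

/-- The fundamental two-form `Φ(X, Y) = g(X, φ Y)`. -/
def fundamentalForm : DiffForm E N 2 := fun x ↦
  twoForm ((innerₗ (TangentSpace 𝓘(ℝ, E) x)).compl₂ (S.φ x).toLinearMap)
    (fun v ↦ S.inner_φ_self x v)
    (continuous_fst.inner ((S.φ x).continuous.comp continuous_snd))

/-- The Nijenhuis tensor `φ²[X, Y] + [φX, φY] - φ[φX, Y] - φ[X, φY]`. -/
def nijenhuis (X Y : Π x : N, TangentSpace 𝓘(ℝ, E) x) (x : N) : TangentSpace 𝓘(ℝ, E) x :=
  S.φ x (S.φ x (VectorField.mlieBracket 𝓘(ℝ, E) X Y x))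
    + VectorField.mlieBracket 𝓘(ℝ, E) (fun y ↦ S.φ y (X y)) (fun y ↦ S.φ y (Y y)) x
    - S.φ x (VectorField.mlieBracket 𝓘(ℝ, E) (fun y ↦ S.φ y (X y)) Y x)
    - S.φ x (VectorField.mlieBracket 𝓘(ℝ, E) X (fun y ↦ S.φ y (Y y)) x)

/-- Normality: the Nijenhuis tensor plus `2 dη ⊗ ξ` vanishes, where `dη` is normalized so that
`2 dη(X, Y) = X η(Y) - Y η(X) - η([X, Y])`. In the normalization of `extD`, the right-hand
side is `dη(X, Y)`, without the factor `2`. -/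
def IsNormal : Prop :=
  ∀ X Y : Π x : N, TangentSpace 𝓘(ℝ, E) x,
    ContMDiff 𝓘(ℝ, E) 𝓘(ℝ, E).tangent ∞ (fun x ↦ (⟨x, X x⟩ : TangentBundle 𝓘(ℝ, E) N)) →
    ContMDiff 𝓘(ℝ, E) 𝓘(ℝ, E).tangent ∞ (fun x ↦ (⟨x, Y x⟩ : TangentBundle 𝓘(ℝ, E) N)) →
    ∀ x, S.nijenhuis X Y x + extD S.ηForm x ![X x, Y x] • S.ξ x = 0

/-- An almost contact metric structure is cosymplectic if `η` and `Φ` are closed and it is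
normal. -/
structure IsCosymplectic : Prop where
  d_η : extD S.ηForm = 0
  d_fundamentalForm : extD S.fundamentalForm = 0
  normal : S.IsNormal

end AlmostContactMetricStructure

end AlmostContact

/-! ### Pointwise slant submanifolds -/

section Slant

/-- The angle in `[0, π/2]` between a nonzero vector `v` and a subspace `W`: the angle between `v`
and its orthogonal projection to `W`, or `π/2` if that projection vanishes. -/
def angleWithSubspace {V : Type*} [NormedAddCommGroup V] [InnerProductSpace ℝ V]
    (v : V) (W : Submodule ℝ V) [W.HasOrthogonalProjection] : ℝ :=
  InnerProductGeometry.angle v (W.starProjection v)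

variable {E : Type*} [NormedAddCommGroup E] [NormedSpace ℝ E] [FiniteDimensional ℝ E]
  {N : Type*} [TopologicalSpace N] [ChartedSpace E N] [IsManifold 𝓘(ℝ, E) ∞ N]
  [RiemannianBundle (fun x : N ↦ TangentSpace 𝓘(ℝ, E) x)]
  {E' : Type*} [NormedAddCommGroup E'] [NormedSpace ℝ E']
  {M : Type*} [TopologicalSpace M] [ChartedSpace E' M]

instance (x : N) : FiniteDimensional ℝ (TangentSpace 𝓘(ℝ, E) x) :=
  inferInstanceAs (FiniteDimensional ℝ E)

/-- A smooth map `f : M → N` is a (possibly self-intersecting) submanifold if all its differentials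
are injective. -/
structure IsImmersedSubmanifold (f : M → N) : Prop where
  contMDiff : ContMDiff 𝓘(ℝ, E') 𝓘(ℝ, E) ∞ f
  injective_mfderiv : ∀ p, Function.Injective (mfderiv 𝓘(ℝ, E') 𝓘(ℝ, E) f p)

/-- The tangent space `T_p M` of the submanifold `f : M → N`, inside the tangent space of `N`. -/
def tangentSpaceIn (f : M → N) (p : M) : Submodule ℝ (TangentSpace 𝓘(ℝ, E) (f p)) :=
  LinearMap.range (mfderiv 𝓘(ℝ, E') 𝓘(ℝ, E) f p).toLinearMap

namespace AlmostContactMetricStructure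

variable (S : AlmostContactMetricStructure E N) (f : M → N)

/-- The space `M_p` of all tangent vectors of the submanifold at `p` which are orthogonal to `ξ`. -/
def slantSpace (p : M) : Submodule ℝ (TangentSpace 𝓘(ℝ, E) (f p)) :=
  tangentSpaceIn (E' := E') f p ⊓ (ℝ ∙ S.ξ (f p))ᗮ

/-- `θ` is a slant function of the submanifold: for each `p`, the angle between `φ X` and `M_p` is
`θ p` for all nonzero `X ∈ M_p`. -/
def IsSlantFunction (θ : M → ℝ) : Prop :=
  ∀ (p : M), ∀ X ∈ S.slantSpace (E' := E') f p, X ≠ 0 →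
    angleWithSubspace (S.φ (f p) X) (S.slantSpace (E' := E') f p) = θ p

/-- The submanifold is proper pointwise slant: it has a slant function with values in
`[0, π/2)`. -/
def IsProperPointwiseSlant : Prop :=
  ∃ θ : M → ℝ, S.IsSlantFunction (E' := E') f θ ∧ ∀ p, θ p ∈ Ico 0 (Real.pi / 2)

/-- The vector field `ξ` is normal to the submanifold. -/
def IsNormalTo : Prop :=
  ∀ (p : M), ∀ X ∈ tangentSpaceIn (E' := E') f p, inner ℝ X (S.ξ (f p)) = 0

/-- The tangential part `T X` of `φ X`, for a vector `X` tangent to `M`. Here `T_p M` is identified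
with its image in the tangent space of `N`, where `T X` lives. -/
def T (p : M) : TangentSpace 𝓘(ℝ, E') p →L[ℝ] TangentSpace 𝓘(ℝ, E) (f p) :=
  (tangentSpaceIn (E' := E') f p).starProjection ∘L S.φ (f p) ∘L
    mfderiv 𝓘(ℝ, E') 𝓘(ℝ, E) f p

lemma inner_T_self (p : M) (X : TangentSpace 𝓘(ℝ, E') p) :
    inner ℝ (mfderiv 𝓘(ℝ, E') 𝓘(ℝ, E) f p X) (S.T f p X) = 0 := by
  have hX : mfderiv 𝓘(ℝ, E') 𝓘(ℝ, E) f p X ∈ tangentSpaceIn (E' := E') f p := ⟨X, rfl⟩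
  change inner ℝ _ ((tangentSpaceIn (E' := E') f p).starProjection
    (S.φ (f p) (mfderiv 𝓘(ℝ, E') 𝓘(ℝ, E) f p X))) = 0
  rw [← Submodule.inner_starProjection_left_eq_right,
    Submodule.starProjection_eq_self_iff.2 hX]
  exact S.inner_φ_self _ _

/-- The two-form `Ω(X, Y) = g(X, T Y)` on the submanifold. -/
def slantForm : DiffForm E' M 2 := fun p ↦
  twoForm ((innerₗ (TangentSpace 𝓘(ℝ, E) (f p))).compl₁₂
      (mfderiv 𝓘(ℝ, E') 𝓘(ℝ, E) f p).toLinearMap (S.T f p).toLinearMap)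
    (fun X ↦ S.inner_T_self f p X)
    (((mfderiv 𝓘(ℝ, E') 𝓘(ℝ, E) f p).continuous.comp continuous_fst).inner
      ((S.T f p).continuous.comp continuous_snd))

end AlmostContactMetricStructure

end Slant

end SlantGeometry

end

/-! The form `Ω` is symplectic on `M`, and powers of a symplectic form on a compact manifold are
never exact. For tangent `X` the projection in `g(X, TY)` can be dropped, so `Ω` is the pullback of
`Φ` under `f` (`slantForm_eq_pullbackForm`); it is smooth and closed because `Φ` is. Since `ξ` is
normal, `M_p` is all of `T_pM`, and an angle below `π/2` forces `TX ≠ 0` for `X ≠ 0`. Then `Ω(TX, X)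
= |TX|² > 0`, so `Ω` is nondegenerate (`slantForm_nondegenerate`).

Linear algebra makes `Ω^m` nowhere zero (`powTwo_ne_zero`). If `Ω^i = dβ` with `1 ≤ i ≤ m`,
closedness of `Ω` gives `Ω^(i+1) = d(Ω ∧ β)` (`extD_wedgeForm`), and eventually `Ω^m` is exact. This
contradicts Stokes' theorem (`not_exists_extD_eq`). Degree zero is separate: the constant `1` is not
in `exactForms E M 0 = ⊥`.

Stokes' theorem needs no orientation here. A nowhere vanishing top form `ω₀` supplies the positive
density `|ω₀|`, and a partition of unity reduces the integral to compactly supported forms in the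
model space. The powers are formed with `wedgeTwo`, twice the wedge product, so `powForm Ω i` is
`2^i Ω^i`; the constants do not affect exactness. -/

noncomputable section

set_option maxSynthPendingDepth 3

namespace SlantGeometry

/-! ### Exterior multiplication by a two-form, and its Leibniz rule. -/

section Algebra

open ContinuousAlternatingMap ContinuousLinearMap

variable {E : Type*} [NormedAddCommGroup E] [NormedSpace ℝ E]
  {F : Type*} [NormedAddCommGroup F] [NormedSpace ℝ F] {k : ℕ}

lemma map_two_swap (τ : E [⋀^Fin 2]→L[ℝ] ℝ) (u v : E) : τ ![u, v] = -τ ![v, u] := by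
  rw [← τ.coe_toAlternatingMap, ← τ.toAlternatingMap.map_swap ![v, u] (i := 0) (j := 1) (by decide)]
  congr 1
  ext i
  fin_cases i <;> rfl

/-- A two-form, as a bilinear map. -/
def curryTwo : (E [⋀^Fin 2]→L[ℝ] ℝ) →L[ℝ] E →L[ℝ] E →L[ℝ] ℝ :=
  compL ℝ E (E [⋀^Fin 1]→L[ℝ] ℝ) (E →L[ℝ] ℝ)
      (ofSubsingletonLIE (0 : Fin 1)).symm.toContinuousLinearEquiv.toContinuousLinearMap ∘L
    curryLeftLI.toContinuousLinearMap

lemma curryTwo_apply (τ : E [⋀^Fin 2]→L[ℝ] ℝ) (u v : E) : curryTwo τ u v = τ ![u, v] := by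
  change τ.curryLeft u (fun _ ↦ v) = _
  rw [curryLeft_apply_apply]
  congr 1
  ext i
  fin_cases i <;> rfl

/-- Alternatization of a bilinear map with values in alternating forms. -/
def alternatizeTwo : (E →L[ℝ] E →L[ℝ] E [⋀^Fin k]→L[ℝ] ℝ) →L[ℝ] E [⋀^Fin (k + 2)]→L[ℝ] ℝ :=
  alternatizeUncurryFinCLM ℝ E ℝ ∘L compL ℝ E _ _ (alternatizeUncurryFinCLM ℝ E ℝ)

lemma alternatizeTwo_apply (G : E →L[ℝ] E →L[ℝ] E [⋀^Fin k]→L[ℝ] ℝ) :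
    alternatizeTwo G = alternatizeUncurryFin (alternatizeUncurryFinCLM ℝ E ℝ ∘L G) := rfl

/-- The sum `G + G.flip` is symmetric, and alternatizing a symmetric map twice gives zero; this is
the algebra behind `d ∘ d = 0`. -/
lemma alternatizeTwo_flip (G : E →L[ℝ] E →L[ℝ] E [⋀^Fin k]→L[ℝ] ℝ) :
    alternatizeTwo G.flip = -alternatizeTwo G := by
  rw [eq_neg_iff_add_eq_zero, ← map_add, alternatizeTwo_apply]
  exact alternatizeUncurryFin_alternatizeUncurryFinCLM_comp_of_symmetric
    fun x y ↦ by simp [add_comm]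

/-- Exterior multiplication of a form `α` by a two-form `τ`; this is twice the usual wedge
product `τ ∧ α`. -/
def wedgeTwo : (E [⋀^Fin k]→L[ℝ] ℝ) →L[ℝ] (E [⋀^Fin 2]→L[ℝ] ℝ) →L[ℝ] E [⋀^Fin (k + 2)]→L[ℝ] ℝ :=
  (compL ℝ (E [⋀^Fin 2]→L[ℝ] ℝ) (E →L[ℝ] E →L[ℝ] ℝ) (E [⋀^Fin (k + 2)]→L[ℝ] ℝ)).flip curryTwo ∘L
    compL ℝ (E →L[ℝ] E →L[ℝ] ℝ) (E →L[ℝ] E →L[ℝ] E [⋀^Fin k]→L[ℝ] ℝ)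
      (E [⋀^Fin (k + 2)]→L[ℝ] ℝ) alternatizeTwo ∘L
    compL ℝ E (E →L[ℝ] ℝ) (E →L[ℝ] E [⋀^Fin k]→L[ℝ] ℝ) ∘L
    (smulRightL ℝ E (E [⋀^Fin k]→L[ℝ] ℝ)).flip

lemma wedgeTwo_apply (α : E [⋀^Fin k]→L[ℝ] ℝ) (τ : E [⋀^Fin 2]→L[ℝ] ℝ) :
    wedgeTwo α τ = alternatizeTwo ((smulRightL ℝ E (E [⋀^Fin k]→L[ℝ] ℝ)).flip α ∘L curryTwo τ) :=
  rfl

lemma alternatizeUncurryFin_compContinuousLinearMap (G : F →L[ℝ] F [⋀^Fin k]→L[ℝ] ℝ)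
    (P : E →L[ℝ] F) :
    (alternatizeUncurryFin G).compContinuousLinearMap P =
      alternatizeUncurryFin (compContinuousLinearMapCLM P ∘L G ∘L P) := by
  ext v
  simp [alternatizeUncurryFin_apply, compContinuousLinearMapCLM]
  rfl

lemma wedgeTwo_compContinuousLinearMap (α : F [⋀^Fin k]→L[ℝ] ℝ) (τ : F [⋀^Fin 2]→L[ℝ] ℝ)
    (P : E →L[ℝ] F) :
    (wedgeTwo α τ).compContinuousLinearMap P =
      wedgeTwo (α.compContinuousLinearMap P) (τ.compContinuousLinearMap P) := by
  rw [wedgeTwo_apply, wedgeTwo_apply, alternatizeTwo_apply, alternatizeTwo_apply,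
    alternatizeUncurryFin_compContinuousLinearMap]
  congr 1
  ext1 u
  change (alternatizeUncurryFin _).compContinuousLinearMap P = alternatizeUncurryFin _
  rw [alternatizeUncurryFin_compContinuousLinearMap]
  congr 1
  ext v w
  simp [curryTwo_apply, compContinuousLinearMapCLM]
  left
  congr 1
  ext i
  fin_cases i <;> rfl

lemma alternatizeUncurryFin_alternatizeTwo (K : E →L[ℝ] E →L[ℝ] E →L[ℝ] E [⋀^Fin k]→L[ℝ] ℝ) :
    alternatizeUncurryFin (alternatizeTwo ∘L K) =
      alternatizeTwo (compL ℝ E (E →L[ℝ] E [⋀^Fin k]→L[ℝ] ℝ) (E [⋀^Fin (k + 1)]→L[ℝ] ℝ)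
        (alternatizeUncurryFinCLM ℝ E ℝ) ∘L K) := rfl

/-- The alternatization of a trilinear map is invariant under cyclic permutations. -/
lemma alternatize_cyclic (G : E →L[ℝ] E →L[ℝ] E →L[ℝ] E [⋀^Fin k]→L[ℝ] ℝ)
    (H : E →L[ℝ] E →L[ℝ] E →L[ℝ] E [⋀^Fin k]→L[ℝ] ℝ) (h : ∀ u v w, H u v w = G w u v) :
    alternatizeUncurryFin (alternatizeTwo ∘L H) = alternatizeUncurryFin (alternatizeTwo ∘L G) := by
  -- A 3-cycle is two transpositions. Swapping the last two arguments gives `H'`, swapping the first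
  -- two then leads to `G`; each swap costs one sign through `alternatizeTwo_flip`.
  let H' : E →L[ℝ] E →L[ℝ] E →L[ℝ] E [⋀^Fin k]→L[ℝ] ℝ :=
    (flipₗᵢ ℝ E E (E [⋀^Fin k]→L[ℝ] ℝ)).toContinuousLinearEquiv.toContinuousLinearMap ∘L H
  have h1 : alternatizeUncurryFin (alternatizeTwo ∘L H) =
      -alternatizeUncurryFin (alternatizeTwo ∘L H') := by
    have : alternatizeTwo ∘L H' = (-1 : ℝ) • (alternatizeTwo ∘L H) := by
      ext1 u
      simpa [H'] using alternatizeTwo_flip (H u)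
    rw [this, alternatizeUncurryFin_smul]
    simp
  rw [h1, alternatizeUncurryFin_alternatizeTwo, ← alternatizeTwo_flip,
    alternatizeUncurryFin_alternatizeTwo]
  congr 1
  ext1 u
  ext1 v
  change alternatizeUncurryFin _ = alternatizeUncurryFin _
  congr 1
  ext1 w
  exact h _ _ _

/-- The differentiated slot has to move past the two slots of `τ`, an even permutation, so no sign
appears. -/
lemma alternatizeUncurryFin_wedgeTwo (α' : E →L[ℝ] E [⋀^Fin k]→L[ℝ] ℝ) (τ : E [⋀^Fin 2]→L[ℝ] ℝ) :
    alternatizeUncurryFin (wedgeTwo.flip τ ∘L α') = wedgeTwo (alternatizeUncurryFin α') τ := by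
  let G : E →L[ℝ] E →L[ℝ] E →L[ℝ] E [⋀^Fin k]→L[ℝ] ℝ :=
    (compL ℝ E (E →L[ℝ] ℝ) (E →L[ℝ] E [⋀^Fin k]→L[ℝ] ℝ)).flip (curryTwo τ) ∘L
      (smulRightL ℝ E (E [⋀^Fin k]→L[ℝ] ℝ)).flip ∘L α'
  let H : E →L[ℝ] E →L[ℝ] E →L[ℝ] E [⋀^Fin k]→L[ℝ] ℝ :=
    compL ℝ E ℝ (E →L[ℝ] E [⋀^Fin k]→L[ℝ] ℝ) (toSpanSingleton ℝ α') ∘L curryTwo τ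
  have h := alternatize_cyclic G H fun u v w ↦ by simp [G, H]
  refine h.symm.trans ((alternatizeUncurryFin_alternatizeTwo H).trans <| congrArg alternatizeTwo ?_)
  ext1 u
  ext1 v
  change alternatizeUncurryFin (curryTwo τ u v • α') = curryTwo τ u v • alternatizeUncurryFin α'
  rw [alternatizeUncurryFin_smul]

set_option synthInstance.maxHeartbeats 200000 in
-- The three cyclic shifts of `τ' ⊗ α` have the same alternatization, while their sum vanishes
-- because `τ'` is closed; hence three times the alternatization is zero.
lemma alternatizeUncurryFin_wedgeTwo_of_closed (α : E [⋀^Fin k]→L[ℝ] ℝ)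
    (τ' : E →L[ℝ] E [⋀^Fin 2]→L[ℝ] ℝ) (h : alternatizeUncurryFin τ' = 0) :
    alternatizeUncurryFin (wedgeTwo α ∘L τ') = 0 := by
  let cyc (G : E →L[ℝ] E →L[ℝ] E →L[ℝ] E [⋀^Fin k]→L[ℝ] ℝ) :
      E →L[ℝ] E →L[ℝ] E →L[ℝ] E [⋀^Fin k]→L[ℝ] ℝ :=
    (flipₗᵢ ℝ E E (E [⋀^Fin k]→L[ℝ] ℝ)).toContinuousLinearEquiv.toContinuousLinearMap ∘L G.flip
  let G : E →L[ℝ] E →L[ℝ] E →L[ℝ] E [⋀^Fin k]→L[ℝ] ℝ :=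
    compL ℝ E (E →L[ℝ] ℝ) (E →L[ℝ] E [⋀^Fin k]→L[ℝ] ℝ)
      ((smulRightL ℝ E (E [⋀^Fin k]→L[ℝ] ℝ)).flip α) ∘L curryTwo ∘L τ'
  have h1 := alternatize_cyclic G (cyc G) fun u v w ↦ rfl
  have h2 := alternatize_cyclic (cyc G) (cyc (cyc G)) fun u v w ↦ rfl
  have h3 : G + cyc G + cyc (cyc G) = 0 := by
    ext1 u
    ext1 v
    ext1 w
    have h4 := (Fin.sum_univ_three _).symm.trans <|
      (alternatizeUncurryFin_apply τ' ![u, v, w]).symm.trans (congrArg (fun β ↦ β ![u, v, w]) h)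
    have e0 : Fin.removeNth 0 ![u, v, w] = ![v, w] := by ext i; fin_cases i <;> rfl
    have e1 : Fin.removeNth 1 ![u, v, w] = ![u, w] := by ext i; fin_cases i <;> rfl
    have e2 : Fin.removeNth 2 ![u, v, w] = ![u, v] := by ext i; fin_cases i <;> rfl
    rw [e0, e1, e2] at h4
    change (curryTwo (τ' u) v w) • α + (curryTwo (τ' w) u v) • α + (curryTwo (τ' v) w u) • α = 0
    rw [← add_smul, ← add_smul]
    simp only [curryTwo_apply]
    rw [map_two_swap (τ' v) w u]
    simp at h4
    rw [add_right_comm, h4, zero_smul]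
  let Λ : (E →L[ℝ] E →L[ℝ] E →L[ℝ] E [⋀^Fin k]→L[ℝ] ℝ) →L[ℝ] E [⋀^Fin (k + 3)]→L[ℝ] ℝ :=
    alternatizeUncurryFinCLM ℝ E ℝ ∘L compL ℝ E (E →L[ℝ] E →L[ℝ] E [⋀^Fin k]→L[ℝ] ℝ)
      (E [⋀^Fin (k + 2)]→L[ℝ] ℝ) alternatizeTwo
  have h5 : Λ G + Λ (cyc G) + Λ (cyc (cyc G)) = 0 := by
    rw [← _root_.map_add, ← _root_.map_add, h3, _root_.map_zero]
  change alternatizeUncurryFin (alternatizeTwo ∘L G) +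
      alternatizeUncurryFin (alternatizeTwo ∘L cyc G) +
      alternatizeUncurryFin (alternatizeTwo ∘L cyc (cyc G)) = 0 at h5
  rw [h2, h1] at h5
  change alternatizeUncurryFin (alternatizeTwo ∘L G) = 0
  ext v
  have := congrArg (fun β ↦ β v) h5
  simp at this ⊢
  linarith

lemma extDeriv_wedgeTwo {α : E → E [⋀^Fin k]→L[ℝ] ℝ} {τ : E → E [⋀^Fin 2]→L[ℝ] ℝ} {x : E}
    (hα : DifferentiableAt ℝ α x) (hτ : DifferentiableAt ℝ τ x) (h : extDeriv τ x = 0) :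
    extDeriv (fun y ↦ wedgeTwo (α y) (τ y)) x = wedgeTwo (extDeriv α x) (τ x) := by
  have := hasFDerivAt_of_bilinear (wedgeTwo (E := E) (k := k)) hα.hasFDerivAt hτ.hasFDerivAt
  rw [extDeriv, this.fderiv, alternatizeUncurryFin_add, extDeriv, ← alternatizeUncurryFin_wedgeTwo]
  have h0 := alternatizeUncurryFin_wedgeTwo_of_closed (α x) _ h
  exact (congrArg₂ (· + ·) h0 rfl).trans (zero_add _)

/-- Induction on the degree: a `(k+1)`-form is `1/(k+1)` times the alternatization of its own
currying, and currying a pullback in direction `u` gives the pullback of the `k`-form `α.curryLeft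
(P u)`. -/
lemma contDiff_compContinuousLinearMap [FiniteDimensional ℝ E] :
    ContDiff ℝ ∞ (fun p : (F [⋀^Fin k]→L[ℝ] ℝ) × (E →L[ℝ] F) ↦
      p.1.compContinuousLinearMap p.2) := by
  induction k with
  | zero =>
    have : (fun p : (F [⋀^Fin 0]→L[ℝ] ℝ) × (E →L[ℝ] F) ↦ p.1.compContinuousLinearMap p.2) =
      fun p ↦ constOfIsEmptyLIE ℝ E ℝ (Fin 0) ((constOfIsEmptyLIE ℝ F ℝ (Fin 0)).symm p.1) := by
      ext p v
      obtain ⟨q, hq⟩ := (constOfIsEmptyLIE ℝ F ℝ (Fin 0)).surjective p.1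
      simp [← hq]
    rw [this]
    fun_prop
  | succ k ih =>
    have : (fun p : (F [⋀^Fin (k + 1)]→L[ℝ] ℝ) × (E →L[ℝ] F) ↦ p.1.compContinuousLinearMap p.2) =
      fun p ↦ ((k + 1 : ℕ) : ℝ)⁻¹ • alternatizeUncurryFinCLM ℝ E ℝ
        (p.1.compContinuousLinearMap p.2).curryLeft := by
      ext1 p
      rw [alternatizeUncurryFinCLM_apply, alternatizeUncurryFin_curryLeft, ← Nat.cast_smul_eq_nsmul ℝ,
        smul_smul, inv_mul_cancel₀ (by positivity), one_smul]
    rw [this]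
    have h : ContDiff ℝ ∞ (fun p : (F [⋀^Fin (k + 1)]→L[ℝ] ℝ) × (E →L[ℝ] F) ↦
        (p.1.compContinuousLinearMap p.2).curryLeft) := by
      refine contDiff_clm_apply_iff.2 fun u ↦ ?_
      simp only [curryLeft_compContinuousLinearMap]
      refine ih.comp (ContDiff.prodMk ?_ contDiff_snd)
      have h1 : ContDiff ℝ ∞ (fun p : (F [⋀^Fin (k + 1)]→L[ℝ] ℝ) × (E →L[ℝ] F) ↦
          p.1.curryLeft) :=
        (curryLeftLI (𝕜 := ℝ) (E := F) (F := ℝ) (n := k)).contDiff.comp contDiff_fst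
      exact h1.clm_apply (contDiff_snd.clm_apply contDiff_const)
    exact ((alternatizeUncurryFinCLM ℝ E ℝ (n := k)).contDiff.comp h).const_smul _

end Algebra

/-! ### Contractions, and nonvanishing of the powers of a nondegenerate two-form. -/

section Power

open ContinuousAlternatingMap ContinuousLinearMap

variable {E : Type*} [NormedAddCommGroup E] [NormedSpace ℝ E]
  {k : ℕ}

/-- The powers of a two-form `τ`, with respect to `wedgeTwo`. -/
def powTwo (τ : E [⋀^Fin 2]→L[ℝ] ℝ) : (i : ℕ) → E [⋀^Fin (2 * i)]→L[ℝ] ℝ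
  | 0 => constOfIsEmpty ℝ E (Fin 0) 1
  | i + 1 => wedgeTwo (powTwo τ i) τ

lemma powTwo_succ (τ : E [⋀^Fin 2]→L[ℝ] ℝ) (i : ℕ) :
    powTwo τ (i + 1) = wedgeTwo (powTwo τ i) τ := rfl

/-- The exterior product of a covector and a form. -/
def wedgeOne (l : E →L[ℝ] ℝ) (β : E [⋀^Fin k]→L[ℝ] ℝ) : E [⋀^Fin (k + 1)]→L[ℝ] ℝ :=
  alternatizeUncurryFin (smulRightL ℝ E (E [⋀^Fin k]→L[ℝ] ℝ) l β)

/-- Contraction with a vector, as a linear map on forms. -/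
def contract (e : E) : (E [⋀^Fin (k + 1)]→L[ℝ] ℝ) →L[ℝ] E [⋀^Fin k]→L[ℝ] ℝ :=
  (ContinuousLinearMap.apply ℝ (E [⋀^Fin k]→L[ℝ] ℝ) e) ∘L
    (curryLeftLI (𝕜 := ℝ) (E := E) (F := ℝ) (n := k)).toContinuousLinearMap

lemma contract_apply (e : E) (β : E [⋀^Fin (k + 1)]→L[ℝ] ℝ) (v : Fin k → E) :
    contract e β v = β (Matrix.vecCons e v) := rfl

omit [NormedAddCommGroup E] [NormedSpace ℝ E] in
lemma removeNth_succ_vecCons (e : E) (v : Fin (k + 1) → E) (i : Fin (k + 1)) :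
    i.succ.removeNth (Matrix.vecCons e v) = Matrix.vecCons e (i.removeNth v) := by
  ext j
  refine Fin.cases ?_ (fun j ↦ ?_) j <;> simp [Fin.removeNth]

/-- The `i = 0` summand removes `e` and leaves `G e`; in every other summand `e` stays first and the
index shift produces the minus sign. -/
lemma contract_alternatizeUncurryFin (G : E →L[ℝ] E [⋀^Fin (k + 1)]→L[ℝ] ℝ) (e : E) :
    contract e (alternatizeUncurryFin G) = G e - alternatizeUncurryFin (contract e ∘L G) := by
  ext v
  rw [contract_apply, alternatizeUncurryFin_apply, Fin.sum_univ_succ,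
    ContinuousAlternatingMap.sub_apply,
    alternatizeUncurryFin_apply, sub_eq_add_neg, ← Finset.sum_neg_distrib]
  congr 1
  · simp
  · refine Finset.sum_congr rfl fun i _ ↦ ?_
    rw [removeNth_succ_vecCons]
    simp [pow_succ, contract_apply]

lemma contract_alternatizeUncurryFin_zero (G : E →L[ℝ] E [⋀^Fin 0]→L[ℝ] ℝ) (e : E) :
    contract e (alternatizeUncurryFin G) = G e := by
  ext v
  rw [contract_apply, alternatizeUncurryFin_apply]
  simp

lemma wedgeTwo_wedgeOne (l : E →L[ℝ] ℝ) (β : E [⋀^Fin k]→L[ℝ] ℝ) (τ : E [⋀^Fin 2]→L[ℝ] ℝ) :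
    wedgeTwo (wedgeOne l β) τ = wedgeOne l (wedgeTwo β τ) := by
  rw [wedgeOne, ← alternatizeUncurryFin_wedgeTwo, wedgeOne]
  congr 1
  ext u : 1
  simp

lemma curryTwo_swap (τ : E [⋀^Fin 2]→L[ℝ] ℝ) (u v : E) : curryTwo τ u v = -curryTwo τ v u := by
  rw [curryTwo_apply, curryTwo_apply, map_two_swap]

/-- The antiderivation rule for contraction. The factor `2` reflects the normalization of
`wedgeTwo`: `e` can enter either slot of `τ`, and antisymmetry makes the two contributions equal. -/
lemma contract_wedgeTwo (β : E [⋀^Fin (k + 1)]→L[ℝ] ℝ) (τ : E [⋀^Fin 2]→L[ℝ] ℝ) (e : E) :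
    contract e (wedgeTwo β τ) = (2 : ℝ) • wedgeOne (curryTwo τ e) β + wedgeTwo (contract e β) τ := by
  let S := (smulRightL ℝ E (E [⋀^Fin (k + 1)]→L[ℝ] ℝ)).flip β
  have h1 : contract e ∘L (alternatizeUncurryFinCLM ℝ E ℝ ∘L (S ∘L curryTwo τ)) =
      -(S (curryTwo τ e)) - alternatizeUncurryFinCLM ℝ E ℝ ∘L
        ((smulRightL ℝ E (E [⋀^Fin k]→L[ℝ] ℝ)).flip (contract e β) ∘L curryTwo τ) := by
    ext1 u
    refine (contract_alternatizeUncurryFin _ e).trans ?_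
    change curryTwo τ u e • β - _ = -(curryTwo τ e u • β) - _
    rw [curryTwo_swap, neg_smul]
    congr 2
  rw [wedgeTwo_apply, alternatizeTwo_apply]
  refine (contract_alternatizeUncurryFin _ e).trans ?_
  rw [h1, ← alternatizeUncurryFinCLM_apply, _root_.map_sub, _root_.map_neg, two_smul]
  change wedgeOne (curryTwo τ e) β - (-wedgeOne (curryTwo τ e) β - wedgeTwo (contract e β) τ) = _
  abel

lemma contract_wedgeTwo_zero (β : E [⋀^Fin 0]→L[ℝ] ℝ) (τ : E [⋀^Fin 2]→L[ℝ] ℝ) (e : E) :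
    contract e (wedgeTwo β τ) = (2 : ℝ) • wedgeOne (curryTwo τ e) β := by
  let S := (smulRightL ℝ E (E [⋀^Fin 0]→L[ℝ] ℝ)).flip β
  have h1 : contract e ∘L (alternatizeUncurryFinCLM ℝ E ℝ ∘L (S ∘L curryTwo τ)) =
      -(S (curryTwo τ e)) := by
    ext1 u
    refine (contract_alternatizeUncurryFin_zero _ e).trans ?_
    change curryTwo τ u e • β = -(curryTwo τ e u • β)
    rw [curryTwo_swap, neg_smul]
  rw [wedgeTwo_apply, alternatizeTwo_apply]
  refine (contract_alternatizeUncurryFin _ e).trans ?_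
  rw [h1, ← alternatizeUncurryFinCLM_apply, _root_.map_neg, two_smul]
  change wedgeOne (curryTwo τ e) β - (-wedgeOne (curryTwo τ e) β) = _
  abel

lemma contract_powTwo_succ (τ : E [⋀^Fin 2]→L[ℝ] ℝ) (i : ℕ) (e : E) :
    contract e (powTwo τ (i + 1)) = (2 * (i + 1) : ℝ) • wedgeOne (curryTwo τ e) (powTwo τ i) := by
  induction i with
  | zero =>
    rw [powTwo_succ]
    refine (contract_wedgeTwo_zero _ _ _).trans ?_
    simp
  | succ i ih =>
    have h := contract_wedgeTwo (powTwo τ (i + 1)) τ e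
    have h2 : wedgeTwo (contract e (powTwo τ (i + 1))) τ =
        (2 * (i + 1) : ℝ) • wedgeOne (curryTwo τ e) (powTwo τ (i + 1)) := by
      rw [powTwo_succ τ i, ← wedgeTwo_wedgeOne, ← _root_.smul_apply, ← _root_.map_smul, ← ih,
        powTwo_succ]
    refine h.trans ?_
    rw [h2, ← add_smul]
    push_cast
    congr 1
    ring

lemma wedgeOne_apply_of_forall_eq_zero (l : E →L[ℝ] ℝ) (β : E [⋀^Fin k]→L[ℝ] ℝ) (e : E)
    (v : Fin k → E) (h : ∀ j, l (v j) = 0) :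
    wedgeOne l β (Matrix.vecCons e v) = l e * β v := by
  rw [wedgeOne, alternatizeUncurryFin_apply, Fin.sum_univ_succ]
  simp [h]

lemma powTwo_ne_zero [FiniteDimensional ℝ E] (τ : E [⋀^Fin 2]→L[ℝ] ℝ)
    (hτ : ∀ e ≠ 0, ∃ v, τ ![e, v] ≠ 0) (i : ℕ) (hi : 2 * i ≤ Module.finrank ℝ E) :
    powTwo τ i ≠ 0 := by
  induction i with
  | zero =>
    intro h
    have := congrArg (fun β ↦ β 0) h
    simp [powTwo] at this
  | succ i ih =>
    intro h
    refine ih (by omega) ?_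
    ext v
    -- As `2 * i` is less than the dimension, some `e ≠ 0` is `τ`-orthogonal to all `v j`.
    -- Contracting `τ^(i+1) = 0` with `e` and evaluating on `(w, v)` leaves only `τ(e, w) τ^i(v) =
    -- 0`.
    let P : E →ₗ[ℝ] (Fin (2 * i) → ℝ) := LinearMap.pi fun j ↦ ((curryTwo τ).flip (v j)).toLinearMap
    have hP : LinearMap.ker P ≠ ⊥ := LinearMap.ker_ne_bot_of_finrank_lt (by simp; omega)
    obtain ⟨e, he, he0⟩ := Submodule.exists_mem_ne_zero_of_ne_bot hP
    obtain ⟨w, hw⟩ := hτ e he0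
    have h1 := contract_powTwo_succ τ i e
    have h2 : ∀ j, curryTwo τ e (v j) = 0 := fun j ↦ congrFun he j
    rw [h, _root_.map_zero, eq_comm, smul_eq_zero] at h1
    have h3 := h1.resolve_left (by positivity)
    have h4 := wedgeOne_apply_of_forall_eq_zero _ (powTwo τ i) w v h2
    rw [h3, curryTwo_apply] at h4
    simpa [hw] using h4

end Power

/-! ### Pullbacks, chart independence of `extD`, and the wedge with a closed two-form. -/

section Pullback

open Filter Topology

variable {E : Type*} [NormedAddCommGroup E] [NormedSpace ℝ E]
  {M : Type*} [TopologicalSpace M] [ChartedSpace E M]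
  {F : Type*} [NormedAddCommGroup F] [NormedSpace ℝ F]
  {N : Type*} [TopologicalSpace N] [ChartedSpace F N] {k : ℕ}

/-- The pullback of a differential form under a map. -/
def pullbackForm (f : M → N) (α : DiffForm F N k) : DiffForm E M k :=
  fun p ↦ (α (f p)).compContinuousLinearMap (mfderiv 𝓘(ℝ, E) 𝓘(ℝ, F) f p)

/-- The expression of a map in the preferred charts at two points. -/
def chartMap (f : M → N) (x : M) (q : N) : E → F :=
  extChartAt 𝓘(ℝ, F) q ∘ f ∘ (extChartAt 𝓘(ℝ, E) x).symm

variable [IsManifold 𝓘(ℝ, E) ∞ M] [IsManifold 𝓘(ℝ, F) ∞ N]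

lemma contMDiffAt_extChartAt_symm' {x : M} {y : E} (hy : y ∈ (extChartAt 𝓘(ℝ, E) x).target) :
    ContMDiffAt 𝓘(ℝ, E) 𝓘(ℝ, E) ∞ (extChartAt 𝓘(ℝ, E) x).symm y :=
  (contMDiffOn_extChartAt_symm x).contMDiffAt ((isOpen_extChartAt_target x).mem_nhds hy)

lemma contDiffAt_chartMap {f : M → N} (hf : ContMDiff 𝓘(ℝ, E) 𝓘(ℝ, F) ∞ f) {x : M} {q : N} {y : E}
    (hy : y ∈ (extChartAt 𝓘(ℝ, E) x).target)
    (hq : f ((extChartAt 𝓘(ℝ, E) x).symm y) ∈ (extChartAt 𝓘(ℝ, F) q).source) :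
    ContDiffAt ℝ ∞ (chartMap f x q : E → F) y := by
  rw [← contMDiffAt_iff_contDiffAt]
  have h1 : ContMDiffAt 𝓘(ℝ, E) 𝓘(ℝ, F) ∞ (f ∘ (extChartAt 𝓘(ℝ, E) x).symm) y :=
    ContMDiffAt.comp y (hf _) (contMDiffAt_extChartAt_symm' hy)
  have h2 : ContMDiffAt 𝓘(ℝ, F) 𝓘(ℝ, F) ∞ (extChartAt 𝓘(ℝ, F) q)
      (f ((extChartAt 𝓘(ℝ, E) x).symm y)) :=
    contMDiffAt_extChartAt' (by rwa [extChartAt_source] at hq)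
  exact h2.comp y h1

/-- Near a point, the coordinate expression of a pullback is a pullback of a coordinate expression
under the coordinate expression of the map. -/
lemma inChart_pullbackForm_apply {f : M → N} (hf : ContMDiff 𝓘(ℝ, E) 𝓘(ℝ, F) ∞ f)
    (α : DiffForm F N k) {x : M} {q : N} {y : E}
    (hy : y ∈ (extChartAt 𝓘(ℝ, E) x).target)
    (hq : f ((extChartAt 𝓘(ℝ, E) x).symm y) ∈ (extChartAt 𝓘(ℝ, F) q).source) :
    inChart (pullbackForm f α) x y =
      (inChart α q (chartMap f x q y)).compContinuousLinearMap (fderiv ℝ (chartMap f x q) y) := by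
  have hcomp : f ∘ (extChartAt 𝓘(ℝ, E) x).symm =ᶠ[𝓝 y]
      (extChartAt 𝓘(ℝ, F) q).symm ∘ chartMap f x q := by
    have hc : ContinuousAt (f ∘ (extChartAt 𝓘(ℝ, E) x).symm) y :=
      (ContMDiffAt.comp y (hf _) (contMDiffAt_extChartAt_symm' hy)).continuousAt
    filter_upwards [hc.preimage_mem_nhds ((isOpen_extChartAt_source q).mem_nhds hq)] with z hz
    exact ((extChartAt 𝓘(ℝ, F) q).left_inv hz).symm
  have h1 : (mfderiv 𝓘(ℝ, E) 𝓘(ℝ, F) (f ∘ (extChartAt 𝓘(ℝ, E) x).symm) y : E →L[ℝ] F) =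
      (mfderiv 𝓘(ℝ, E) 𝓘(ℝ, F) f ((extChartAt 𝓘(ℝ, E) x).symm y)) ∘L
        (mfderiv 𝓘(ℝ, E) 𝓘(ℝ, E) (extChartAt 𝓘(ℝ, E) x).symm y) :=
    mfderiv_comp y ((hf _).mdifferentiableAt (by simp))
      ((contMDiffAt_extChartAt_symm' hy).mdifferentiableAt (by simp))
  have hF := contDiffAt_chartMap hf hy hq
  have hFy : chartMap f x q y ∈ (extChartAt 𝓘(ℝ, F) q).target :=
    (extChartAt 𝓘(ℝ, F) q).map_source hq
  have hm : MDifferentiableAt 𝓘(ℝ, E) 𝓘(ℝ, F) (chartMap f x q) y :=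
    (hF.differentiableAt (by simp)).mdifferentiableAt
  have hs : MDifferentiableAt 𝓘(ℝ, F) 𝓘(ℝ, F) (extChartAt 𝓘(ℝ, F) q).symm (chartMap f x q y) :=
    (contMDiffAt_extChartAt_symm' hFy).mdifferentiableAt (by simp)
  let A : F →L[ℝ] F := mfderiv 𝓘(ℝ, F) 𝓘(ℝ, F) (extChartAt 𝓘(ℝ, F) q).symm (chartMap f x q y)
  have h2 : (mfderiv 𝓘(ℝ, E) 𝓘(ℝ, F) ((extChartAt 𝓘(ℝ, F) q).symm ∘ chartMap f x q) y :
      E →L[ℝ] F) = A ∘L (fderiv ℝ (chartMap f x q) y) :=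
    (mfderiv_comp y hs hm).trans (congrArg (fun P : E →L[ℝ] F ↦ A ∘L P) mfderiv_eq_fderiv)
  have h3 := h1.symm.trans ((hcomp.mfderiv_eq (I := 𝓘(ℝ, E)) (I' := 𝓘(ℝ, F))).trans h2)
  let α' : N → F [⋀^Fin k]→L[ℝ] ℝ := α
  have h4 : α' (f ((extChartAt 𝓘(ℝ, E) x).symm y)) =
      α' ((extChartAt 𝓘(ℝ, F) q).symm (chartMap f x q y)) := congrArg α' hcomp.self_of_nhds
  exact congrArg₂ (fun (β : F [⋀^Fin k]→L[ℝ] ℝ) (P : E →L[ℝ] F) ↦ β.compContinuousLinearMap P) h4 h3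

omit [IsManifold 𝓘(ℝ, F) ∞ N] in
lemma eventually_chartMap_mem {f : M → N} (hf : ContMDiff 𝓘(ℝ, E) 𝓘(ℝ, F) ∞ f) {x : M} {q : N}
    {y : E} (hy : y ∈ (extChartAt 𝓘(ℝ, E) x).target)
    (hq : f ((extChartAt 𝓘(ℝ, E) x).symm y) ∈ (extChartAt 𝓘(ℝ, F) q).source) :
    ∀ᶠ z in 𝓝 y, z ∈ (extChartAt 𝓘(ℝ, E) x).target ∧
      f ((extChartAt 𝓘(ℝ, E) x).symm z) ∈ (extChartAt 𝓘(ℝ, F) q).source := by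
  have hc : ContinuousAt (f ∘ (extChartAt 𝓘(ℝ, E) x).symm) y :=
    (ContMDiffAt.comp y (hf _) (contMDiffAt_extChartAt_symm' hy)).continuousAt
  exact Filter.inter_mem ((isOpen_extChartAt_target x).mem_nhds hy)
    (hc.preimage_mem_nhds ((isOpen_extChartAt_source q).mem_nhds hq))

lemma inChart_pullbackForm {f : M → N} (hf : ContMDiff 𝓘(ℝ, E) 𝓘(ℝ, F) ∞ f)
    (α : DiffForm F N k) {x : M} {q : N} {y : E}
    (hy : y ∈ (extChartAt 𝓘(ℝ, E) x).target)
    (hq : f ((extChartAt 𝓘(ℝ, E) x).symm y) ∈ (extChartAt 𝓘(ℝ, F) q).source) :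
    inChart (pullbackForm f α) x =ᶠ[𝓝 y] fun z ↦
      (inChart α q (chartMap f x q z)).compContinuousLinearMap (fderiv ℝ (chartMap f x q) z) := by
  filter_upwards [eventually_chartMap_mem hf hy hq] with z hz
  exact inChart_pullbackForm_apply hf α hz.1 hz.2

omit [IsManifold 𝓘(ℝ, E) ∞ M] in
lemma IsSmoothForm.contDiffAt {α : DiffForm E M k} (hα : IsSmoothForm α) {x : M} {y : E}
    (hy : y ∈ (extChartAt 𝓘(ℝ, E) x).target) : ContDiffAt ℝ ∞ (inChart α x) y :=
  (hα x).contDiffAt ((isOpen_extChartAt_target x).mem_nhds hy)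

lemma IsSmoothForm.pullbackForm [FiniteDimensional ℝ E] {f : M → N}
    (hf : ContMDiff 𝓘(ℝ, E) 𝓘(ℝ, F) ∞ f) {α : DiffForm F N k} (hα : IsSmoothForm α) :
    IsSmoothForm (pullbackForm f α : DiffForm E M k) := by
  intro x y hy
  have hq := mem_extChartAt_source (I := 𝓘(ℝ, F)) (f ((extChartAt 𝓘(ℝ, E) x).symm y))
  refine (ContDiffAt.congr_of_eventuallyEq ?_ (inChart_pullbackForm hf α hy hq)).contDiffWithinAt
  have hF := contDiffAt_chartMap hf hy hq
  have h1 := (hα.contDiffAt ((extChartAt 𝓘(ℝ, F) _).map_source hq)).comp y hF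
  have h2 : ContDiffAt ℝ ∞ (fderiv ℝ (chartMap f x _)) y := hF.fderiv_right (by simp)
  exact contDiff_compContinuousLinearMap.contDiffAt.comp y (h1.prodMk h2)

/-- The exterior derivative of a pullback, in coordinates. -/
lemma extDeriv_inChart_pullbackForm {f : M → N}
    (hf : ContMDiff 𝓘(ℝ, E) 𝓘(ℝ, F) ∞ f) {α : DiffForm F N k} (hα : IsSmoothForm α)
    {x : M} {q : N} {y : E} (hy : y ∈ (extChartAt 𝓘(ℝ, E) x).target)
    (hq : f ((extChartAt 𝓘(ℝ, E) x).symm y) ∈ (extChartAt 𝓘(ℝ, F) q).source) :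
    extDeriv (inChart (SlantGeometry.pullbackForm f α) x) y =
      (extDeriv (inChart α q) (chartMap f x q y)).compContinuousLinearMap
        (fderiv ℝ (chartMap f x q) y) := by
  rw [(inChart_pullbackForm hf α hy hq).extDeriv_eq]
  exact extDeriv_pullback ((hα.contDiffAt ((extChartAt 𝓘(ℝ, F) _).map_source hq)).differentiableAt
    (by simp)) (contDiffAt_chartMap hf hy hq)
      (r := ∞)
      (by simpa [minSmoothness_of_isRCLikeNormedField] using
        (WithTop.coe_le_coe.2 le_top : ((2 : ℕ∞) : ℕ∞ω) ≤ ∞))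

omit [IsManifold 𝓘(ℝ, E) ∞ M] in
lemma pullbackForm_id (α : DiffForm E M k) : pullbackForm id α = α := by
  funext x
  ext v
  simp [pullbackForm]

/-- The exterior derivative can be computed in any chart. -/
lemma inChart_extD {α : DiffForm E M k} (hα : IsSmoothForm α) {x : M} {y : E}
    (hy : y ∈ (extChartAt 𝓘(ℝ, E) x).target) :
    inChart (extD α) x y = extDeriv (inChart α x) y := by
  -- `extD` at `p` is defined in the preferred chart at `p`; comparing it with the chart at `x` is
  -- the pullback formula for the identity map.
  set p := (extChartAt 𝓘(ℝ, E) x).symm y with hp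
  have h := extDeriv_inChart_pullbackForm contMDiff_id hα (x := x) (q := p) hy
    (mem_extChartAt_source p)
  rw [pullbackForm_id] at h
  rw [h]
  have h1 : (fderiv ℝ (chartMap id x p) y : E →L[ℝ] E) =
      (mfderiv 𝓘(ℝ, E) 𝓘(ℝ, E) (extChartAt 𝓘(ℝ, E) p) p) ∘L
        (mfderiv 𝓘(ℝ, E) 𝓘(ℝ, E) (extChartAt 𝓘(ℝ, E) x).symm y) := by
    rw [← mfderiv_eq_fderiv]
    exact mfderiv_comp y
      ((contMDiffAt_extChartAt (I := 𝓘(ℝ, E)) (n := ∞) (x := p)).mdifferentiableAt (by simp))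
      ((contMDiffAt_extChartAt_symm' hy).mdifferentiableAt (by simp))
  rw [h1]
  rfl

lemma extD_pullbackForm_eq_zero {f : M → N} (hf : ContMDiff 𝓘(ℝ, E) 𝓘(ℝ, F) ∞ f)
    {α : DiffForm F N k} (hα : IsSmoothForm α) (h : extD α = 0) :
    extD (pullbackForm f α : DiffForm E M k) = 0 := by
  funext x
  have hx := mem_extChartAt_target (I := 𝓘(ℝ, E)) x
  have hq : f ((extChartAt 𝓘(ℝ, E) x).symm (extChartAt 𝓘(ℝ, E) x x)) ∈
    (extChartAt 𝓘(ℝ, F) (f x)).source := by simp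
  have h1 : extDeriv (inChart α (f x)) (chartMap f x (f x) (extChartAt 𝓘(ℝ, E) x x)) = 0 := by
    refine (inChart_extD hα ((extChartAt 𝓘(ℝ, F) (f x)).map_source hq)).symm.trans ?_
    rw [h]
    rfl
  have h2 := extDeriv_inChart_pullbackForm hf hα hx hq
  rw [h1] at h2
  rw [extD, h2]
  rfl

/-! ### Exterior multiplication by a two-form -/

/-- Exterior multiplication by a two-form. -/
def wedgeForm (Ω : DiffForm E M 2) (α : DiffForm E M k) : DiffForm E M (k + 2) :=
  fun x ↦ (wedgeTwo (E := E) (α x) (Ω x) : E [⋀^Fin (k + 2)]→L[ℝ] ℝ)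

omit [IsManifold 𝓘(ℝ, E) ∞ M] in
lemma inChart_wedgeForm (Ω : DiffForm E M 2) (α : DiffForm E M k) (x : M) :
    inChart (wedgeForm Ω α) x = fun y ↦ wedgeTwo (inChart α x y) (inChart Ω x y) := by
  funext y
  exact wedgeTwo_compContinuousLinearMap (E := E) (F := E) _ _ _

omit [IsManifold 𝓘(ℝ, E) ∞ M] in
lemma IsSmoothForm.wedgeForm {Ω : DiffForm E M 2} {α : DiffForm E M k} (hΩ : IsSmoothForm Ω)
    (hα : IsSmoothForm α) : IsSmoothForm (wedgeForm Ω α) := fun x ↦ by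
  rw [inChart_wedgeForm]
  exact ((wedgeTwo (E := E) (k := k)).contDiff.comp_contDiffOn (hα x)).clm_apply (hΩ x)

/-- Lets an undifferentiated factor pass through the definition of `extD`, which goes to the chart
and back. -/
lemma inChart_compContinuousLinearMap (α : DiffForm E M k) (x : M) :
    (inChart α x (extChartAt 𝓘(ℝ, E) x x)).compContinuousLinearMap
      (mfderiv 𝓘(ℝ, E) 𝓘(ℝ, E) (extChartAt 𝓘(ℝ, E) x) x) = α x := by
  have h1 : (mfderiv 𝓘(ℝ, E) 𝓘(ℝ, E) (extChartAt 𝓘(ℝ, E) x).symm (extChartAt 𝓘(ℝ, E) x x) :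
      E →L[ℝ] E) ∘L (mfderiv 𝓘(ℝ, E) 𝓘(ℝ, E) (extChartAt 𝓘(ℝ, E) x) x) =
      ContinuousLinearMap.id ℝ E := by
    have h := mfderivWithin_extChartAt_symm_comp_mfderiv_extChartAt' (I := 𝓘(ℝ, E))
      (mem_extChartAt_source (I := 𝓘(ℝ, E)) x)
    rw [ModelWithCorners.range_eq_univ, mfderivWithin_univ] at h
    exact h
  have h2 : (extChartAt 𝓘(ℝ, E) x).symm (extChartAt 𝓘(ℝ, E) x x) = x := extChartAt_to_inv x
  let α' : M → E [⋀^Fin k]→L[ℝ] ℝ := α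
  exact congrArg₂ (fun (β : E [⋀^Fin k]→L[ℝ] ℝ) (P : E →L[ℝ] E) ↦ β.compContinuousLinearMap P)
    (congrArg α' h2) h1

lemma extD_wedgeForm {Ω : DiffForm E M 2} {α : DiffForm E M k} (hΩ : IsSmoothForm Ω)
    (hα : IsSmoothForm α) (h : extD Ω = 0) : extD (wedgeForm Ω α) = wedgeForm Ω (extD α) := by
  funext x
  have hx := mem_extChartAt_target (I := 𝓘(ℝ, E)) x
  have h0 : extDeriv (inChart Ω x) (extChartAt 𝓘(ℝ, E) x x) = 0 := by
    rw [← inChart_extD hΩ hx, h]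
    rfl
  have h1 := extDeriv_wedgeTwo (hα.differentiableAt x) (hΩ.differentiableAt x) h0
  rw [extD, inChart_wedgeForm, h1]
  refine (wedgeTwo_compContinuousLinearMap (E := E) (F := E) _ _ _).trans ?_
  exact congrArg (wedgeTwo (E := E) _) (inChart_compContinuousLinearMap Ω x)

end Pullback

/-! ### Top forms, integration in the model space and change of charts. -/

section TopForms

open Filter Topology MeasureTheory

variable {E : Type*} [NormedAddCommGroup E] [NormedSpace ℝ E] {k d : ℕ}

lemma topForm_eq_smul (b : Module.Basis (Fin d) ℝ E) (α β : E [⋀^Fin d]→L[ℝ] ℝ) (h : β b ≠ 0) :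
    α = (α b / β b) • β := by
  have hα := α.toAlternatingMap.eq_smul_basis_det b
  have hβ := β.toAlternatingMap.eq_smul_basis_det b
  ext v
  have h1 := congrArg (fun f ↦ f v) hα
  have h2 := congrArg (fun f ↦ f v) hβ
  simp at h1 h2 ⊢
  rw [h1, h2]
  field_simp

lemma topForm_basis_ne_zero (b : Module.Basis (Fin d) ℝ E) {β : E [⋀^Fin d]→L[ℝ] ℝ} (h : β ≠ 0) :
    β b ≠ 0 := by
  intro h0
  have hβ := β.toAlternatingMap.eq_smul_basis_det b
  refine h ?_
  ext v
  have h2 := congrArg (fun f ↦ f v) hβ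
  simp at h2 ⊢
  rw [h2, h0, zero_mul]

lemma topForm_compContinuousLinearMap (b : Module.Basis (Fin d) ℝ E) (β : E [⋀^Fin d]→L[ℝ] ℝ)
    (P : E →L[ℝ] E) : β.compContinuousLinearMap P b = P.det * β b := by
  have hβ := β.toAlternatingMap.eq_smul_basis_det b
  have h2 := congrArg (fun f ↦ f (P ∘ b)) hβ
  have h3 := b.det_comp (P : E →ₗ[ℝ] E) b
  simp [b.det_self] at h2 h3
  rw [h3] at h2
  simp [h2, ContinuousLinearMap.det, mul_comm]

variable [MeasurableSpace E] [BorelSpace E] [FiniteDimensional ℝ E]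
  (μ : Measure E) [μ.IsAddHaarMeasure]

/-- Integration by parts against the constant function `1`. -/
lemma integral_fderiv_apply_eq_zero {g : E → ℝ} (hg : ContDiff ℝ 1 g) (hc : HasCompactSupport g)
    (v : E) : ∫ x, fderiv ℝ g x v ∂μ = 0 := by
  have hi : Integrable (fun x ↦ fderiv ℝ g x v) μ :=
    ((hg.continuous_fderiv (by simp)).clm_apply continuous_const).integrable_of_hasCompactSupport
      ((hc.fderiv (𝕜 := ℝ)).comp_left (g := fun L : E →L[ℝ] ℝ ↦ L v) rfl)
  have h := integral_mul_fderiv_eq_neg_fderiv_mul_of_integrable (μ := μ) (𝕜 := ℝ)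
    (f := fun _ : E ↦ (1 : ℝ)) (g := g) (v := v)
    (by simp) (by simpa using hi)
    (by simpa using hg.continuous.integrable_of_hasCompactSupport hc)
    (fun _ _ ↦ differentiableAt_const _)
    (fun x _ ↦ hg.differentiable (by simp) x)
  simpa using h

lemma integral_extDeriv_apply_eq_zero {γ : E → E [⋀^Fin k]→L[ℝ] ℝ} (hγ : ContDiff ℝ 1 γ)
    (hc : HasCompactSupport γ) (v : Fin (k + 1) → E) : ∫ x, extDeriv γ x v ∂μ = 0 := by
  have hs (i : Fin (k + 1)) : ContDiff ℝ 1 (γ · (i.removeNth v)) :=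
    (ContinuousAlternatingMap.apply ℝ E ℝ (i.removeNth v)).contDiff.comp hγ
  have hsc (i : Fin (k + 1)) : HasCompactSupport (γ · (i.removeNth v)) :=
    hc.comp_left (g := fun α : E [⋀^Fin k]→L[ℝ] ℝ ↦ α (i.removeNth v)) rfl
  have h (x : E) := extDeriv_apply (hγ.differentiable (by simp) x) v
  simp_rw [h, zsmul_eq_mul]
  rw [integral_finsetSum]
  · refine Finset.sum_eq_zero fun i _ ↦ ?_
    rw [integral_const_mul, integral_fderiv_apply_eq_zero μ (hs i) (hsc i), mul_zero]
  · intro i _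
    refine Integrable.const_mul ?_ _
    exact (((hs i).continuous_fderiv (by simp)).clm_apply
      continuous_const).integrable_of_hasCompactSupport
      (((hsc i).fderiv (𝕜 := ℝ)).comp_left (g := fun L : E →L[ℝ] ℝ ↦ L (v i)) rfl)

variable {M : Type*} [TopologicalSpace M] [ChartedSpace E M]

/-- The integral over the chart at `c` of a function with respect to the density of a top form,
computed with the frame `v`. -/
def chartIntegral (ω₀ : DiffForm E M d) (v : Fin d → E) (c : M) (h : M → ℝ) : ℝ :=
  ∫ y in (extChartAt 𝓘(ℝ, E) c).target,
    h ((extChartAt 𝓘(ℝ, E) c).symm y) * |inChart ω₀ c y v| ∂μ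

variable [IsManifold 𝓘(ℝ, E) ∞ M]

omit [MeasurableSpace E] [BorelSpace E] [FiniteDimensional ℝ E] in
lemma inChart_eq_compContinuousLinearMap (α : DiffForm E M d) {x q : M} {y : E}
    (hy : y ∈ (extChartAt 𝓘(ℝ, E) x).target)
    (hq : (extChartAt 𝓘(ℝ, E) x).symm y ∈ (extChartAt 𝓘(ℝ, E) q).source) :
    inChart α x y = (inChart α q (chartMap id x q y)).compContinuousLinearMap
      (fderiv ℝ (chartMap (E := E) (F := E) id x q) y) := by
  have h := inChart_pullbackForm_apply contMDiff_id α hy hq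
  rwa [pullbackForm_id] at h

/-- The part of the target of the chart at `x` which belongs to the chart at `q`. -/
def chartOverlap (x q : M) : Set E :=
  (extChartAt 𝓘(ℝ, E) x).target ∩
    (extChartAt 𝓘(ℝ, E) x).symm ⁻¹' (extChartAt 𝓘(ℝ, E) q).source

omit [MeasurableSpace E] [BorelSpace E] [FiniteDimensional ℝ E] [IsManifold 𝓘(ℝ, E) ∞ M] in
lemma isOpen_chartOverlap (x q : M) : IsOpen (chartOverlap (E := E) x q) :=
  (continuousOn_extChartAt_symm x).isOpen_inter_preimage (isOpen_extChartAt_target x)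
    (isOpen_extChartAt_source q)

omit [MeasurableSpace E] [BorelSpace E] [FiniteDimensional ℝ E] [IsManifold 𝓘(ℝ, E) ∞ M] in
lemma chartMap_chartMap {x q : M} {y : E} (hy : y ∈ chartOverlap (E := E) x q) :
    chartMap (E := E) (F := E) id q x (chartMap (E := E) (F := E) id x q y) = y := by
  simp only [chartMap, Function.comp, id]
  rw [(extChartAt 𝓘(ℝ, E) q).left_inv hy.2, (extChartAt 𝓘(ℝ, E) x).right_inv hy.1]

omit [MeasurableSpace E] [BorelSpace E] [FiniteDimensional ℝ E] [IsManifold 𝓘(ℝ, E) ∞ M] in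
lemma chartMap_mem {x q : M} {y : E} (hy : y ∈ chartOverlap (E := E) x q) :
    chartMap (E := E) (F := E) id x q y ∈ chartOverlap (E := E) q x := by
  refine ⟨(extChartAt 𝓘(ℝ, E) q).map_source hy.2, ?_⟩
  simp only [chartMap, Function.comp, id, mem_preimage]
  rw [(extChartAt 𝓘(ℝ, E) q).left_inv hy.2]
  exact (extChartAt 𝓘(ℝ, E) x).map_target hy.1

omit [FiniteDimensional ℝ E] [μ.IsAddHaarMeasure] [IsManifold 𝓘(ℝ, E) ∞ M] in
lemma chartIntegral_eq_integral_chartOverlap (ω₀ : DiffForm E M d) (v : Fin d → E) (c j : M)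
    (h : M → ℝ) (hj : ∀ p ∉ (extChartAt 𝓘(ℝ, E) j).source, h p = 0) :
    chartIntegral μ ω₀ v c h = ∫ y in chartOverlap c j,
      h ((extChartAt 𝓘(ℝ, E) c).symm y) * |inChart ω₀ c y v| ∂μ := by
  refine setIntegral_eq_of_subset_of_forall_sdiff_eq_zero
    (isOpen_extChartAt_target c).measurableSet inter_subset_left fun y hy ↦ ?_
  rw [hj _ fun hy' ↦ hy.2 ⟨hy.1, hy'⟩, zero_mul]

/-- The integral of a function supported in two charts can be computed in either of them. -/
lemma chartIntegral_eq (ω₀ : DiffForm E M d) (b : Module.Basis (Fin d) ℝ E) (c j : M)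
    (h : M → ℝ) (hc : ∀ p ∉ (extChartAt 𝓘(ℝ, E) c).source, h p = 0)
    (hj : ∀ p ∉ (extChartAt 𝓘(ℝ, E) j).source, h p = 0) :
    chartIntegral μ ω₀ b c h = chartIntegral μ ω₀ b j h := by
  rw [chartIntegral_eq_integral_chartOverlap μ ω₀ b c j h hj,
    chartIntegral_eq_integral_chartOverlap μ ω₀ b j c h hc]
  have himage : chartMap (E := E) (F := E) id c j '' chartOverlap c j = chartOverlap j c := by
    refine Subset.antisymm (image_subset_iff.2 fun y hy ↦ chartMap_mem hy) fun y hy ↦ ?_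
    exact ⟨_, chartMap_mem hy, chartMap_chartMap hy⟩
  rw [← himage, integral_image_eq_integral_abs_det_fderiv_smul μ
    (isOpen_chartOverlap c j).measurableSet (f' := fderiv ℝ (chartMap (E := E) (F := E) id c j))]
  · refine setIntegral_congr_fun (isOpen_chartOverlap c j).measurableSet fun y hy ↦ ?_
    -- A top form scales by the determinant of the transition map, so its absolute value scales by
    -- exactly the Jacobian factor of the substitution.
    rw [inChart_eq_compContinuousLinearMap ω₀ hy.1 hy.2, topForm_compContinuousLinearMap, abs_mul]
    have : (extChartAt 𝓘(ℝ, E) j).symm (chartMap (E := E) (F := E) id c j y) =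
        (extChartAt 𝓘(ℝ, E) c).symm y := (extChartAt 𝓘(ℝ, E) j).left_inv hy.2
    rw [this, smul_eq_mul]
    ring
  · intro y hy
    exact ((contDiffAt_chartMap contMDiff_id hy.1 hy.2).differentiableAt
      (by simp)).hasFDerivAt.hasFDerivWithinAt
  · intro y hy z hz hyz
    rw [← chartMap_chartMap hy, hyz, chartMap_chartMap hz]

end TopForms

/-! ### Stokes' theorem without orientation, and non-exactness of volume forms. -/

section Stokes

open Filter Topology MeasureTheory

variable {E : Type*} [NormedAddCommGroup E] [NormedSpace ℝ E] {k d : ℕ}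
  {M : Type*} [TopologicalSpace M] [ChartedSpace E M]

/-- The product of a function and a form. -/
def functionSMul (ρ : M → ℝ) (γ : DiffForm E M k) : DiffForm E M k := fun x ↦ ρ x • γ x

lemma inChart_functionSMul (ρ : M → ℝ) (γ : DiffForm E M k) (x : M) :
    inChart (functionSMul ρ γ) x =
      fun y ↦ ρ ((extChartAt 𝓘(ℝ, E) x).symm y) • inChart γ x y := rfl

lemma inChart_apply_of_eq_smul {α β : DiffForm E M k} {h : M → ℝ} (H : ∀ p, α p = h p • β p)
    (x : M) (y : E) : inChart α x y = h ((extChartAt 𝓘(ℝ, E) x).symm y) • inChart β x y := by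
  rw [inChart, H]
  rfl

lemma isSmoothForm_sum {ι : Type*} (s : Finset ι) (γ : ι → DiffForm E M k)
    (h : ∀ i, IsSmoothForm (γ i)) :
    IsSmoothForm (∑ i ∈ s, γ i) ∧ extD (∑ i ∈ s, γ i) = ∑ i ∈ s, extD (γ i) := by
  classical
  induction s using Finset.induction_on with
  | empty => exact ⟨IsSmoothForm.zero, extD_zero⟩
  | insert i s hi ih =>
    rw [Finset.sum_insert hi, Finset.sum_insert hi, extD_add (h i) ih.1, ih.2]
    exact ⟨(h i).add ih.1, rfl⟩

lemma DiffForm.sum_apply {ι : Type*} (s : Finset ι) (γ : ι → DiffForm E M k) (p : M) :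
    (∑ i ∈ s, γ i) p = ∑ i ∈ s, γ i p := by
  classical
  induction s using Finset.induction_on with
  | empty => rfl
  | insert i s hi ih =>
    rw [Finset.sum_insert hi, Finset.sum_insert hi, ← ih]
    rfl

variable [IsManifold 𝓘(ℝ, E) ∞ M]

lemma IsSmoothForm.functionSMul {ρ : M → ℝ} (hρ : ContMDiff 𝓘(ℝ, E) 𝓘(ℝ) ∞ ρ)
    {γ : DiffForm E M k} (hγ : IsSmoothForm γ) : IsSmoothForm (functionSMul ρ γ) := fun x ↦ by
  rw [inChart_functionSMul]
  have h : ContDiffOn ℝ ∞ (fun y ↦ ρ ((extChartAt 𝓘(ℝ, E) x).symm y))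
      (extChartAt 𝓘(ℝ, E) x).target := by
    rw [← contMDiffOn_iff_contDiffOn]
    exact hρ.comp_contMDiffOn (contMDiffOn_extChartAt_symm x)
  exact h.smul (hγ x)

lemma IsSmoothForm.extD {α : DiffForm E M k} (hα : IsSmoothForm α) : IsSmoothForm (extD α) :=
  fun x ↦ by
  refine ContDiffOn.congr ?_ fun y hy ↦ inChart_extD hα hy
  exact (ContinuousAlternatingMap.alternatizeUncurryFinCLM ℝ E ℝ).contDiff.comp_contDiffOn
    ((hα x).fderiv_of_isOpen (m := ∞) (isOpen_extChartAt_target x) (by simp))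

omit [IsManifold 𝓘(ℝ, E) ∞ M] in
lemma extD_eq_zero_of_eventually {α : DiffForm E M k} {p : M} (h : ∀ᶠ q in 𝓝 p, α q = 0) :
    extD α p = 0 := by
  have h1 : inChart α p =ᶠ[𝓝 (extChartAt 𝓘(ℝ, E) p p)] 0 := by
    have hc := continuousAt_extChartAt_symm (I := 𝓘(ℝ, E)) p
    rw [ContinuousAt, extChartAt_to_inv] at hc
    filter_upwards [hc.eventually h] with y hy
    rw [inChart, hy]
    rfl
  have h2 : extDeriv (inChart α p) (extChartAt 𝓘(ℝ, E) p p) = 0 := by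
    rw [h1.extDeriv_eq, extDeriv]
    ext v
    simp [ContinuousAlternatingMap.alternatizeUncurryFin_apply]
  rw [SlantGeometry.extD, h2]
  rfl

lemma inChart_ne_zero {ω₀ : DiffForm E M d} (h : ∀ p, ω₀ p ≠ 0) {x : M} {y : E}
    (hy : y ∈ (extChartAt 𝓘(ℝ, E) x).target) : inChart ω₀ x y ≠ 0 := by
  intro h0
  have hq := mem_extChartAt_source (I := 𝓘(ℝ, E)) ((extChartAt 𝓘(ℝ, E) x).symm y)
  have hinv := isInvertible_mfderivWithin_extChartAt_symm (I := 𝓘(ℝ, E)) hy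
  rw [ModelWithCorners.range_eq_univ, mfderivWithin_univ] at hinv
  obtain ⟨P, hP⟩ := hinv
  refine h ((extChartAt 𝓘(ℝ, E) x).symm y) ?_
  ext v
  have h1 := congrArg (fun β : E [⋀^Fin d]→L[ℝ] ℝ ↦ β fun i ↦ P.symm (v i)) h0
  rw [inChart, ← hP] at h1
  refine Eq.trans ?_ h1
  exact congrArg (ω₀ ((extChartAt 𝓘(ℝ, E) x).symm y))
    (funext fun i ↦ (P.apply_symm_apply (v i)).symm)

/-- In a chart, `h` is the quotient of the coefficients of `α` and `ω₀` on the frame `b`. -/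
lemma continuous_of_eq_smul (b : Module.Basis (Fin d) ℝ E) {ω₀ α : DiffForm E M d} {h : M → ℝ}
    (hω : IsSmoothForm ω₀) (hω0 : ∀ p, ω₀ p ≠ 0) (hα : IsSmoothForm α)
    (H : ∀ p, α p = h p • ω₀ p) : Continuous h := by
  rw [continuous_iff_continuousAt]
  intro p
  have hp := mem_extChartAt_target (I := 𝓘(ℝ, E)) p
  have hc (β : DiffForm E M d) (hβ : IsSmoothForm β) :
      ContinuousAt (fun q ↦ inChart β p (extChartAt 𝓘(ℝ, E) p q) b) p :=
    ContinuousAt.comp (f := extChartAt 𝓘(ℝ, E) p) (g := fun y ↦ inChart β p y b)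
      ((ContinuousAlternatingMap.apply ℝ E ℝ b).continuous.continuousAt.comp
        (hβ.contDiffAt hp).continuousAt) (continuousAt_extChartAt p)
  have hne {y : E} (hy : y ∈ (extChartAt 𝓘(ℝ, E) p).target) : inChart ω₀ p y b ≠ 0 :=
    topForm_basis_ne_zero b (inChart_ne_zero hω0 hy)
  refine ((hc α hα).div (hc ω₀ hω) (hne hp)).congr ?_
  filter_upwards [extChartAt_source_mem_nhds (I := 𝓘(ℝ, E)) p] with q hq
  have h1 := inChart_apply_of_eq_smul H p (extChartAt 𝓘(ℝ, E) p q)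
  have h2 := hne ((extChartAt 𝓘(ℝ, E) p).map_source hq)
  rw [(extChartAt 𝓘(ℝ, E) p).left_inv hq] at h1
  simp only [Pi.div_apply, h1]
  exact (div_eq_iff h2).2 rfl

variable [MeasurableSpace E] [BorelSpace E] [FiniteDimensional ℝ E]
  (μ : Measure E) [μ.IsAddHaarMeasure]

/-- Stokes' theorem for a form `β` supported in one chart. -/
lemma chartIntegral_extD_eq_zero [T2Space M] (b : Module.Basis (Fin (k + 1)) ℝ E)
    {ω₀ : DiffForm E M (k + 1)}
    (hω : IsSmoothForm ω₀) (hω0 : ∀ p, ω₀ p ≠ 0) {β : DiffForm E M k} (hβ : IsSmoothForm β)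
    {h : M → ℝ} (H : ∀ p, extD β p = h p • ω₀ p) (c : M) {K : Set M} (hK : IsCompact K)
    (hKc : K ⊆ (extChartAt 𝓘(ℝ, E) c).source) (hβK : ∀ p ∉ K, β p = 0) :
    chartIntegral μ ω₀ b c h = 0 := by
  let w : E → ℝ := fun y ↦ inChart ω₀ c y b
  -- The sign of the coefficient of `ω₀` is locally constant on the chart target, since the
  -- coefficient is continuous and nonzero there. Multiplying `β` by it turns `|ω₀|` into `ω₀` and
  -- commutes with `d`.
  let s : E → ℝ := fun y ↦ if 0 < w y then 1 else -1
  have hw {y : E} (hy : y ∈ (extChartAt 𝓘(ℝ, E) c).target) : w y ≠ 0 :=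
    topForm_basis_ne_zero b (inChart_ne_zero hω0 hy)
  have hwc {y : E} (hy : y ∈ (extChartAt 𝓘(ℝ, E) c).target) : ContinuousAt w y :=
    (ContinuousAlternatingMap.apply ℝ E ℝ b).continuous.continuousAt.comp
        (hω.contDiffAt hy).continuousAt
  have hs (y : E) : |w y| = s y * w y := by
    by_cases h0 : 0 < w y
    · simp [s, h0, abs_of_pos]
    · simp [s, h0, abs_of_nonpos (not_lt.1 h0)]
  have hsc {y : E} (hy : y ∈ (extChartAt 𝓘(ℝ, E) c).target) : ∀ᶠ z in 𝓝 y, s z = s y := by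
    rcases lt_or_gt_of_ne (hw hy) with h0 | h0
    · filter_upwards [(hwc hy).eventually (Iio_mem_nhds h0)] with z hz
      simp [s, not_lt.2 (le_of_lt h0), not_lt.2 (le_of_lt (show w z < 0 from hz))]
    · filter_upwards [(hwc hy).eventually (Ioi_mem_nhds h0)] with z hz
      simp [s, h0, show 0 < w z from hz]
  have hK' : IsCompact (extChartAt 𝓘(ℝ, E) c '' K) :=
    hK.image_of_continuousOn ((continuousOn_extChartAt c).mono hKc)
  classical
  -- Extension by zero stays smooth: it vanishes off the compact image of `K`, which lies inside the
  -- open target.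
  let B : E → E [⋀^Fin k]→L[ℝ] ℝ :=
    (extChartAt 𝓘(ℝ, E) c).target.indicator fun y ↦ s y • inChart β c y
  have hB0 {y : E} (hy : y ∉ extChartAt 𝓘(ℝ, E) c '' K) : B y = 0 := by
    by_cases hyt : y ∈ (extChartAt 𝓘(ℝ, E) c).target
    · have h1 : β ((extChartAt 𝓘(ℝ, E) c).symm y) = 0 :=
        hβK _ fun h1 ↦ hy ⟨_, h1, (extChartAt 𝓘(ℝ, E) c).right_inv hyt⟩
      have h2 : inChart β c y = 0 := by
        rw [inChart, h1]
        rfl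
      simp only [B, indicator_of_mem hyt, h2, smul_zero]
    · exact indicator_of_notMem hyt _
  have hB0' {y : E} (hy : y ∉ extChartAt 𝓘(ℝ, E) c '' K) : B =ᶠ[𝓝 y] fun _ ↦ 0 := by
    filter_upwards [hK'.isClosed.isOpen_compl.mem_nhds hy] with z hz using hB0 hz
  have hBt {y : E} (hy : y ∈ (extChartAt 𝓘(ℝ, E) c).target) :
      B =ᶠ[𝓝 y] s y • inChart β c := by
    filter_upwards [hsc hy, (isOpen_extChartAt_target c).mem_nhds hy] with z hz hzt
    simp only [B, indicator_of_mem hzt, hz, Pi.smul_apply]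
  have hBs : ContDiff ℝ 1 B := by
    rw [contDiff_iff_contDiffAt]
    intro y
    by_cases hy : y ∈ (extChartAt 𝓘(ℝ, E) c).target
    · exact (((hβ.contDiffAt hy).const_smul (s y)).of_le (by simp)).congr_of_eventuallyEq (hBt hy)
    · refine contDiffAt_const.congr_of_eventuallyEq (hB0' fun h1 ↦ hy ?_)
      obtain ⟨p, hp, rfl⟩ := h1
      exact (extChartAt 𝓘(ℝ, E) c).map_source (hKc hp)
  have hBc : HasCompactSupport B := HasCompactSupport.intro hK' fun y hy ↦ hB0 hy
  have h0 := integral_extDeriv_apply_eq_zero μ hBs hBc b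
  rw [← h0, chartIntegral, ← setIntegral_eq_integral_of_forall_compl_eq_zero
    (s := (extChartAt 𝓘(ℝ, E) c).target) (f := fun y ↦ extDeriv B y b)]
  · refine setIntegral_congr_fun (isOpen_extChartAt_target (I := 𝓘(ℝ, E)) c).measurableSet fun y hy ↦ ?_
    have h1 := inChart_apply_of_eq_smul H c y
    rw [inChart_extD hβ hy] at h1
    simp only [(hBt hy).extDeriv_eq, extDeriv_smul, h1]
    change _ * |w y| = s y * (_ * w y)
    rw [hs]
    ring
  · intro y hy
    have h1 := hB0' (y := y) fun h1 ↦ hy (by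
      obtain ⟨p, hp, rfl⟩ := h1
      exact (extChartAt 𝓘(ℝ, E) c).map_source (hKc hp))
    rw [h1.extDeriv_eq, extDeriv]
    simp [ContinuousAlternatingMap.alternatizeUncurryFin_apply]

omit [IsManifold 𝓘(ℝ, E) ∞ M] [FiniteDimensional ℝ E] in
lemma integrableOn_chart (b : Module.Basis (Fin d) ℝ E) {ω₀ : DiffForm E M d}
    (hω : IsSmoothForm ω₀) (c : M) {K : Set M} (hK : IsCompact K)
    (hKc : K ⊆ (extChartAt 𝓘(ℝ, E) c).source) {g : M → ℝ} (hg : Continuous g)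
    (hgK : ∀ p ∉ K, g p = 0) :
    IntegrableOn (fun y ↦ g ((extChartAt 𝓘(ℝ, E) c).symm y) * |inChart ω₀ c y b|)
      (extChartAt 𝓘(ℝ, E) c).target μ := by
  have hK' : IsCompact (extChartAt 𝓘(ℝ, E) c '' K) :=
    hK.image_of_continuousOn ((continuousOn_extChartAt c).mono hKc)
  have hKt : extChartAt 𝓘(ℝ, E) c '' K ⊆ (extChartAt 𝓘(ℝ, E) c).target := by
    rintro _ ⟨p, hp, rfl⟩
    exact (extChartAt 𝓘(ℝ, E) c).map_source (hKc hp)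
  have h1 : ContinuousOn (fun y ↦ g ((extChartAt 𝓘(ℝ, E) c).symm y) * |inChart ω₀ c y b|)
      (extChartAt 𝓘(ℝ, E) c).target := by
    refine (hg.comp_continuousOn (continuousOn_extChartAt_symm c)).mul ?_
    exact ((ContinuousAlternatingMap.apply ℝ E ℝ b).continuous.comp_continuousOn
      (hω c).continuousOn).abs
  refine IntegrableOn.of_forall_sdiff_eq_zero ((h1.mono hKt).integrableOn_compact hK')
    (isOpen_extChartAt_target c).measurableSet fun y hy ↦ ?_
  rw [hgK _ fun h2 ↦ hy.2 ⟨_, h2, (extChartAt 𝓘(ℝ, E) c).right_inv hy.1⟩, zero_mul]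

omit [MeasurableSpace E] [BorelSpace E] in
/-- On a nonempty compact manifold, a nowhere vanishing top form is not exact. -/
theorem not_exists_extD_eq [T2Space M] [CompactSpace M] [Nonempty M]
    (hk : Module.finrank ℝ E = k + 1) {ω₀ : DiffForm E M (k + 1)} (hω0 : ∀ p, ω₀ p ≠ 0) :
    ¬ ∃ γ : DiffForm E M k, IsSmoothForm γ ∧ extD γ = ω₀ := by
  rintro ⟨γ, hγ, hγω⟩
  borelize E
  let μ : Measure E := Measure.addHaar
  let b : Module.Basis (Fin (k + 1)) ℝ E := Module.finBasisOfFinrankEq ℝ E hk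
  have hω : IsSmoothForm ω₀ := hγω ▸ hγ.extD
  obtain ⟨ρ, hρ⟩ := SmoothPartitionOfUnity.exists_isSubordinate_chartAt_source 𝓘(ℝ, E) M
  obtain ⟨I, hI⟩ : ∃ I : Finset M, ∀ i ∉ I, ∀ p, ρ i p = 0 := by
    have hfin := ρ.locallyFinite.finite_nonempty_of_compact
    refine ⟨hfin.toFinset, fun i hi p ↦ ?_⟩
    by_contra h
    exact hi (hfin.mem_toFinset.2 ⟨p, h⟩)
  have hsum (p : M) : ∑ i ∈ I, ρ i p = 1 := by
    rw [← ρ.sum_eq_one (mem_univ p)]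
    exact (finsum_eq_sum_of_support_subset _ fun i hi ↦ by
      by_contra h
      exact hi (hI i h p)).symm
  have hρc (j : M) : Continuous (ρ j) := (ρ j).contMDiff.continuous
  have hK (i : M) : IsCompact (tsupport (ρ i)) := (isClosed_tsupport _).isCompact
  have hKs (i : M) : tsupport (ρ i) ⊆ (extChartAt 𝓘(ℝ, E) i).source := by
    rw [extChartAt_source]
    exact hρ i
  have hρ0 (i p : M) (hp : p ∉ tsupport (ρ i)) : ρ i p = 0 := image_eq_zero_of_notMem_tsupport hp
  let β : M → DiffForm E M k := fun i ↦ functionSMul (ρ i) γ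
  have hβ (i : M) : IsSmoothForm (β i) := IsSmoothForm.functionSMul (ρ i).contMDiff hγ
  -- `h i` is the density of `d(ρ i • γ)` relative to `ω₀`. These functions sum to `1` since `dγ =
  -- ω₀`, and each has zero integral in its own chart.
  let h : M → M → ℝ := fun i p ↦ (show E [⋀^Fin (k + 1)]→L[ℝ] ℝ from extD (β i) p) b /
    (show E [⋀^Fin (k + 1)]→L[ℝ] ℝ from ω₀ p) b
  have hωb (p : M) : (show E [⋀^Fin (k + 1)]→L[ℝ] ℝ from ω₀ p) b ≠ 0 :=
    topForm_basis_ne_zero b (hω0 p)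
  have H (i p : M) : extD (β i) p = h i p • ω₀ p :=
    topForm_eq_smul (E := E) b (extD (β i) p) (ω₀ p) (hωb p)
  have hcont (i : M) : Continuous (h i) := continuous_of_eq_smul b hω hω0 (hβ i).extD (H i)
  have hβsum : ∑ i ∈ I, β i = γ := by
    funext p
    rw [DiffForm.sum_apply]
    change ∑ i ∈ I, ρ i p • γ p = γ p
    rw [← Finset.sum_smul, hsum, one_smul]
  have hhsum (p : M) : ∑ i ∈ I, h i p = 1 := by
    have h1 := (isSmoothForm_sum I β hβ).2
    rw [hβsum, hγω] at h1
    have h2 := congrFun h1 p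
    rw [DiffForm.sum_apply, Finset.sum_congr rfl fun i _ ↦ H i p, ← Finset.sum_smul] at h2
    have h3 : (1 - ∑ i ∈ I, h i p) • ω₀ p = 0 := by
      rw [sub_smul, one_smul, sub_eq_zero]
      exact h2
    have h4 := (smul_eq_zero.1 h3).resolve_right (hω0 p)
    linarith
  have hh0 (i p : M) (hp : p ∉ tsupport (ρ i)) : h i p = 0 := by
    have h1 : extD (β i) p = 0 := by
      refine extD_eq_zero_of_eventually ?_
      filter_upwards [(isClosed_tsupport (ρ i)).isOpen_compl.mem_nhds hp] with q hq
      change ρ i q • γ q = 0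
      rw [hρ0 i q hq, zero_smul]
    simp only [h, h1]
    exact zero_div _
  have hzero (i : M) : chartIntegral μ ω₀ b i (h i) = 0 :=
    chartIntegral_extD_eq_zero μ b hω hω0 (hβ i) (H i) i (hK i) (hKs i) fun p hp ↦ by
      change ρ i p • γ p = 0
      rw [hρ0 i p hp, zero_smul]
  have hint (j i c : M) (hc : c = i ∨ c = j) := integrableOn_chart μ b hω c (hK c) (hKs c)
    (g := fun p ↦ ρ j p * h i p) ((hρc j).mul (hcont i)) fun p hp ↦ by
      rcases hc with rfl | rfl
      · simp [hh0 _ p hp]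
      · simp [hρ0 _ p hp]
  -- The product `ρ j * h i` is supported in both charts, so either one computes its integral.
  have hswap (j i : M) : chartIntegral μ ω₀ b j (fun p ↦ ρ j p * h i p) =
      chartIntegral μ ω₀ b i (fun p ↦ ρ j p * h i p) :=
    chartIntegral_eq μ ω₀ b j i _ (fun p hp ↦ by simp [hρ0 j p fun h' ↦ hp (hKs j h')])
      (fun p hp ↦ by simp [hh0 i p fun h' ↦ hp (hKs i h')])
  have hone (j : M) : ∑ i ∈ I, chartIntegral μ ω₀ b j (fun p ↦ ρ j p * h i p) =
      chartIntegral μ ω₀ b j (ρ j) := by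
    simp only [chartIntegral]
    rw [← integral_finsetSum _ fun i _ ↦ hint j i j (.inr rfl)]
    congr 1
    ext y
    rw [← Finset.sum_mul, ← Finset.mul_sum, hhsum, mul_one]
  have htwo (i : M) : ∑ j ∈ I, chartIntegral μ ω₀ b i (fun p ↦ ρ j p * h i p) = 0 := by
    rw [← hzero i]
    simp only [chartIntegral]
    rw [← integral_finsetSum _ fun j _ ↦ hint j i i (.inl rfl)]
    congr 1
    ext y
    rw [← Finset.sum_mul, ← Finset.sum_mul, hsum, one_mul]
  -- Inserting `∑ h i = 1`, exchanging the sums, changing charts and using `∑ ρ j = 1` turns the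
  -- total volume into `∑ ∫ h i = 0`.
  have htotal : ∑ j ∈ I, chartIntegral μ ω₀ b j (ρ j) = 0 := by
    rw [← Finset.sum_congr rfl fun j _ ↦ hone j, Finset.sum_comm]
    refine Finset.sum_eq_zero fun i _ ↦ ?_
    rw [← htwo i]
    exact Finset.sum_congr rfl fun j _ ↦ hswap j i
  have hnonneg (j : M) : 0 ≤ chartIntegral μ ω₀ b j (ρ j) :=
    integral_nonneg fun y ↦ mul_nonneg (ρ.nonneg j _) (abs_nonneg _)
  obtain ⟨p⟩ := ‹Nonempty M›
  obtain ⟨j, hj⟩ := ρ.exists_pos_of_mem (mem_univ p)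
  have hjI : j ∈ I := by
    by_contra h'
    exact hj.ne' (hI j h' p)
  have hj0 := (Finset.sum_eq_zero_iff_of_nonneg fun j _ ↦ hnonneg j).1 htotal j hjI
  refine absurd hj0 (ne_of_gt ?_)
  have hpos := (integrableOn_chart μ b hω j (hK j) (hKs j) (hρc j) (hρ0 j))
  rw [chartIntegral, setIntegral_pos_iff_support_of_nonneg_ae
    (Eventually.of_forall fun y ↦ mul_nonneg (ρ.nonneg j _) (abs_nonneg _)) hpos]
  -- The contradiction: the integrand for `j` is positive on this nonempty open set, so its term in
  -- a zero sum of nonnegative terms is positive.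
  let U := (extChartAt 𝓘(ℝ, E) j).target ∩ (extChartAt 𝓘(ℝ, E) j).symm ⁻¹' (ρ j ⁻¹' Ioi 0)
  have hU : IsOpen U := (continuousOn_extChartAt_symm j).isOpen_inter_preimage
    (isOpen_extChartAt_target j) (isOpen_Ioi.preimage (hρc j))
  have hps : p ∈ (extChartAt 𝓘(ℝ, E) j).source :=
    hKs j (subset_tsupport _ hj.ne')
  have hpU : extChartAt 𝓘(ℝ, E) j p ∈ U := by
    refine ⟨(extChartAt 𝓘(ℝ, E) j).map_source hps, ?_⟩
    rw [mem_preimage, (extChartAt 𝓘(ℝ, E) j).left_inv hps]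
    exact hj
  refine (hU.measure_pos μ ⟨_, hpU⟩).trans_le (measure_mono fun y hy ↦ ⟨?_, hy.1⟩)
  exact mul_ne_zero (ne_of_gt hy.2)
    (abs_ne_zero.2 (topForm_basis_ne_zero b (inChart_ne_zero hω0 hy.1)))

end Stokes

/-! ### Smoothness of the fundamental form. -/

section Smoothness

variable {E : Type*} [NormedAddCommGroup E] [NormedSpace ℝ E] [FiniteDimensional ℝ E]

/-- In finite dimension the evaluations control the curried form, and a two-form is half the
alternatization of its currying. -/
lemma contDiffOn_of_forall_apply_two {X : Type*} [NormedAddCommGroup X] [NormedSpace ℝ X]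
    {α : X → E [⋀^Fin 2]→L[ℝ] ℝ} {s : Set X}
    (h : ∀ u v : E, ContDiffOn ℝ ∞ (fun x ↦ α x ![u, v]) s) : ContDiffOn ℝ ∞ α s := by
  have h1 : ContDiffOn ℝ ∞ (fun x ↦ (α x).curryLeft) s := by
    refine contDiffOn_clm_apply.2 fun u ↦ ?_
    have h2 : ContDiffOn ℝ ∞ (fun x ↦ curryTwo (α x) u) s := by
      refine contDiffOn_clm_apply.2 fun v ↦ ?_
      simpa only [curryTwo_apply] using h u v
    refine ((ContinuousAlternatingMap.ofSubsingletonLIE (𝕜 := ℝ) (E := E) (F := ℝ)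
      (0 : Fin 1)).contDiff.comp_contDiffOn h2).congr fun x _ ↦ ?_
    exact ((ContinuousAlternatingMap.ofSubsingletonLIE (𝕜 := ℝ) (E := E) (F := ℝ)
      (0 : Fin 1)).apply_symm_apply _).symm
  refine (((ContinuousAlternatingMap.alternatizeUncurryFinCLM ℝ E ℝ
    (n := 1)).contDiff.comp_contDiffOn h1).const_smul (2⁻¹ : ℝ)).congr fun x _ ↦ ?_
  change α x = (2⁻¹ : ℝ) • ContinuousAlternatingMap.alternatizeUncurryFin (α x).curryLeft
  rw [ContinuousAlternatingMap.alternatizeUncurryFin_curryLeft]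
  ext v
  simp

variable {N : Type*} [TopologicalSpace N] [ChartedSpace E N] [IsManifold 𝓘(ℝ, E) ∞ N]
  [RiemannianBundle (fun x : N ↦ TangentSpace 𝓘(ℝ, E) x)]
  [IsContMDiffRiemannianBundle 𝓘(ℝ, E) ∞ E (fun x : N ↦ TangentSpace 𝓘(ℝ, E) x)]

omit [FiniteDimensional ℝ E] [RiemannianBundle (fun x : N ↦ TangentSpace 𝓘(ℝ, E) x)]
  [IsContMDiffRiemannianBundle 𝓘(ℝ, E) ∞ E (fun x : N ↦ TangentSpace 𝓘(ℝ, E) x)] in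
lemma contMDiffOn_mfderiv_extChartAt_symm (x : N) (u : E) :
    ContMDiffOn 𝓘(ℝ, E) 𝓘(ℝ, E).tangent ∞
      (fun y ↦ (⟨(extChartAt 𝓘(ℝ, E) x).symm y,
        mfderiv 𝓘(ℝ, E) 𝓘(ℝ, E) (extChartAt 𝓘(ℝ, E) x).symm y u⟩ : TangentBundle 𝓘(ℝ, E) N))
      (extChartAt 𝓘(ℝ, E) x).target := by
  have h1 := (contMDiffOn_extChartAt_symm (I := 𝓘(ℝ, E)) (n := ∞) x).contMDiffOn_tangentMapWithin
    (m := ∞) (by simp) (isOpen_extChartAt_target x).uniqueMDiffOn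
  have h2 : ContMDiffOn 𝓘(ℝ, E) 𝓘(ℝ, E).tangent ∞
      (fun y : E ↦ (⟨y, u⟩ : TangentBundle 𝓘(ℝ, E) E)) (extChartAt 𝓘(ℝ, E) x).target :=
    contMDiffOn_vectorSpace_iff_contDiffOn.2 contDiffOn_const
  refine (h1.comp h2 fun y hy ↦ hy).congr fun y hy ↦ ?_
  simp only [Function.comp, tangentMapWithin]
  rw [mfderivWithin_of_isOpen (isOpen_extChartAt_target x) hy]

lemma AlmostContactMetricStructure.isSmoothForm_fundamentalForm
    (S : AlmostContactMetricStructure E N) : IsSmoothForm S.fundamentalForm := by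
  intro x
  refine contDiffOn_of_forall_apply_two fun u v ↦ ?_
  rw [← contMDiffOn_iff_contDiffOn]
  have hu := contMDiffOn_mfderiv_extChartAt_symm (N := N) x u
  have hv := contMDiffOn_mfderiv_extChartAt_symm (N := N) x v
  have hφ := S.contMDiff_φ.comp_contMDiffOn (contMDiffOn_extChartAt_symm (I := 𝓘(ℝ, E)) (n := ∞) x)
  exact ContMDiffOn.inner_bundle (E := fun x : N ↦ TangentSpace 𝓘(ℝ, E) x)
    hu (hφ.clm_bundle_apply hv)

end Smoothness

/-! ### The slant form as a pullback, and its nondegeneracy. -/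

section Slant

variable {E : Type*} [NormedAddCommGroup E] [NormedSpace ℝ E] [FiniteDimensional ℝ E]
  {N : Type*} [TopologicalSpace N] [ChartedSpace E N] [IsManifold 𝓘(ℝ, E) ∞ N]
  [RiemannianBundle (fun x : N ↦ TangentSpace 𝓘(ℝ, E) x)]
  {E' : Type*} [NormedAddCommGroup E'] [NormedSpace ℝ E']
  {M : Type*} [TopologicalSpace M] [ChartedSpace E' M]

namespace AlmostContactMetricStructure

variable (S : AlmostContactMetricStructure E N) (f : M → N)

lemma slantForm_eq_pullbackForm :
    (S.slantForm f : DiffForm E' M 2) = pullbackForm f S.fundamentalForm := by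
  funext p
  ext v
  change inner ℝ (mfderiv 𝓘(ℝ, E') 𝓘(ℝ, E) f p (v 0))
    ((tangentSpaceIn (E' := E') f p).starProjection
      (S.φ (f p) (mfderiv 𝓘(ℝ, E') 𝓘(ℝ, E) f p (v 1)))) =
    inner ℝ (mfderiv 𝓘(ℝ, E') 𝓘(ℝ, E) f p (v 0))
      (S.φ (f p) (mfderiv 𝓘(ℝ, E') 𝓘(ℝ, E) f p (v 1)))
  have hX : mfderiv 𝓘(ℝ, E') 𝓘(ℝ, E) f p (v 0) ∈ tangentSpaceIn (E := E) (E' := E') f p :=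
    ⟨v 0, rfl⟩
  rw [← Submodule.inner_starProjection_left_eq_right, Submodule.starProjection_eq_self_iff.2 hX]

lemma slantForm_nondegenerate (hf : IsImmersedSubmanifold (E := E) (E' := E') f)
    (hslant : S.IsProperPointwiseSlant (E' := E') f) (hξ : S.IsNormalTo (E' := E') f)
    (p : M) (e : TangentSpace 𝓘(ℝ, E') p) (he : e ≠ 0) :
    ∃ v : TangentSpace 𝓘(ℝ, E') p, S.slantForm f p ![e, v] ≠ 0 := by
  obtain ⟨θ, hθ, hθ2⟩ := hslant
  set X := mfderiv 𝓘(ℝ, E') 𝓘(ℝ, E) f p e with hX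
  have hX0 : X ≠ 0 := fun h ↦ he (hf.injective_mfderiv p (by rw [← hX, h, map_zero]))
  have hspace : S.slantSpace (E' := E') f p = tangentSpaceIn (E' := E') f p := by
    refine inf_eq_left.2 fun Y hY ↦ ?_
    rw [Submodule.mem_orthogonal_singleton_iff_inner_left]
    exact hξ p Y hY
  have hXmem : X ∈ tangentSpaceIn (E := E) (E' := E') f p := ⟨e, rfl⟩
  have hangle := hθ p X (hspace ▸ hXmem) hX0
  rw [angleWithSubspace] at hangle
  have hproj : (S.slantSpace (E' := E') f p).starProjection (S.φ (f p) X) ≠ 0 := by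
    intro h
    -- The angle with the zero vector is `π/2` by convention, which properness excludes.
    rw [h, InnerProductGeometry.angle_zero_right] at hangle
    exact (hθ2 p).2.ne hangle.symm
  obtain ⟨v, hv⟩ : (S.slantSpace (E' := E') f p).starProjection (S.φ (f p) X) ∈
      tangentSpaceIn (E := E) (E' := E') f p := by
    rw [← hspace]
    exact Submodule.starProjection_apply_mem _ _
  -- The witness `v` represents the tangential part of `φ X`, so `Ω(v, e)` is its squared norm.
  refine ⟨v, fun h ↦ hproj ?_⟩
  have h1 : S.slantForm f p ![v, e] = 0 :=
    (map_two_swap (E := E') (S.slantForm f p) v e).trans ((congrArg Neg.neg h).trans neg_zero)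
  change inner ℝ (mfderiv 𝓘(ℝ, E') 𝓘(ℝ, E) f p v)
    ((tangentSpaceIn (E' := E') f p).starProjection (S.φ (f p) X)) = 0 at h1
  change mfderiv 𝓘(ℝ, E') 𝓘(ℝ, E) f p v = _ at hv
  simp only [hspace] at hv ⊢
  rwa [hv, inner_self_eq_zero] at h1

end AlmostContactMetricStructure

end Slant

/-! ### Powers of a symplectic form in de Rham cohomology. -/

section Cohomology

variable {E : Type*} [NormedAddCommGroup E] [NormedSpace ℝ E] [FiniteDimensional ℝ E]
  {M : Type*} [TopologicalSpace M] [ChartedSpace E M] [IsManifold 𝓘(ℝ, E) ∞ M]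

/-- The powers of a two-form on a manifold. -/
def powForm (Ω : DiffForm E M 2) : (i : ℕ) → DiffForm E M (2 * i)
  | 0 => fun _ ↦ ContinuousAlternatingMap.constOfIsEmpty ℝ E (Fin 0) (1 : ℝ)
  | i + 1 => wedgeForm Ω (powForm Ω i)

omit [FiniteDimensional ℝ E] [IsManifold 𝓘(ℝ, E) ∞ M] in
lemma powForm_apply (Ω : DiffForm E M 2) (i : ℕ) (p : M) :
    powForm Ω i p = powTwo (E := E) (Ω p) i := by
  induction i with
  | zero => rfl
  | succ i ih =>
    change wedgeTwo (E := E) (powForm Ω i p) (Ω p) = _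
    rw [ih]
    rfl

omit [FiniteDimensional ℝ E] [IsManifold 𝓘(ℝ, E) ∞ M] in
lemma const_zeroForm_mem_closedForms (c : ℝ) :
    (fun _ ↦ ContinuousAlternatingMap.constOfIsEmpty ℝ E (Fin 0) c : DiffForm E M 0) ∈
      closedForms E M 0 := by
  have h (x : M) : inChart (fun _ ↦ ContinuousAlternatingMap.constOfIsEmpty ℝ E (Fin 0) c :
      DiffForm E M 0) x = fun _ ↦ ContinuousAlternatingMap.constOfIsEmpty ℝ E (Fin 0) c := by
    funext y
    ext v
    rfl
  refine ⟨fun x ↦ ?_, ?_⟩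
  · rw [h]
    exact contDiffOn_const
  · funext x
    have h1 : extDeriv (inChart (fun _ ↦ ContinuousAlternatingMap.constOfIsEmpty ℝ E (Fin 0) c :
      DiffForm E M 0) x) (extChartAt 𝓘(ℝ, E) x x) = 0 := by
      rw [h, extDeriv]
      ext v
      simp [ContinuousAlternatingMap.alternatizeUncurryFin_apply]
    change (extDeriv _ _).compContinuousLinearMap _ = _
    rw [h1]
    rfl

omit [FiniteDimensional ℝ E] [IsManifold 𝓘(ℝ, E) ∞ M] in
lemma wedgeForm_zero_right {k : ℕ} (Ω : DiffForm E M 2) : wedgeForm Ω (0 : DiffForm E M k) = 0 := by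
  funext p
  change wedgeTwo (E := E) (0 : E [⋀^Fin k]→L[ℝ] ℝ) (Ω p) = 0
  rw [map_zero]
  rfl

omit [FiniteDimensional ℝ E] in
lemma powForm_mem_closedForms {Ω : DiffForm E M 2} (hΩ : Ω ∈ closedForms E M 2) (i : ℕ) :
    powForm Ω i ∈ closedForms E M (2 * i) := by
  induction i with
  | zero => exact const_zeroForm_mem_closedForms 1
  | succ i ih =>
    refine ⟨hΩ.1.wedgeForm ih.1, ?_⟩
    exact (extD_wedgeForm hΩ.1 ih.1 hΩ.2).trans (by rw [ih.2, wedgeForm_zero_right])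

omit [FiniteDimensional ℝ E] in
lemma powForm_exact_succ {Ω : DiffForm E M 2} (hΩ : Ω ∈ closedForms E M 2) {i : ℕ}
    (h : powForm Ω (i + 1) ∈ exactForms E M (2 * (i + 1))) :
    powForm Ω (i + 2) ∈ exactForms E M (2 * (i + 2)) := by
  obtain ⟨β, hβ, hβΩ⟩ := h
  refine ⟨wedgeForm Ω β, hΩ.1.wedgeForm hβ, ?_⟩
  exact (extD_wedgeForm hΩ.1 hβ hΩ.2).trans (by rw [hβΩ]; rfl)

/-- The powers of a symplectic form on a nonempty compact manifold are not exact. -/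
theorem powForm_notMem_exactForms [T2Space M] [CompactSpace M] [Nonempty M] {m : ℕ}
    (hm : Module.finrank ℝ E = 2 * m) {Ω : DiffForm E M 2} (hΩ : Ω ∈ closedForms E M 2)
    (hnd : ∀ (p : M) (e : TangentSpace 𝓘(ℝ, E) p), e ≠ 0 →
      ∃ v : TangentSpace 𝓘(ℝ, E) p, Ω p ![e, v] ≠ 0) {i : ℕ} (hi : i ≤ m) :
    powForm Ω i ∉ exactForms E M (2 * i) := by
  have hne (p : M) (j : ℕ) (hj : j ≤ m) : powForm Ω j p ≠ 0 := by
    rw [powForm_apply]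
    exact powTwo_ne_zero (E := E) (Ω p) (hnd p) j (by omega)
  rcases i with - | i
  · intro h
    obtain ⟨p⟩ := ‹Nonempty M›
    exact hne p 0 (by omega) (congrFun (show powForm Ω 0 = 0 from h) p)
  · intro h
    obtain ⟨m, rfl⟩ : ∃ j, m = j + 1 := ⟨m - 1, by omega⟩
    -- Exactness propagates upward from `Ω^(i+1)` to the top power, a nowhere vanishing top form.
    have htop (j : ℕ) (hj : i ≤ j) : powForm Ω (j + 1) ∈ exactForms E M (2 * (j + 1)) := by
      induction j, hj using Nat.le_induction with
      | base => exact h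
      | succ j hj ih => exact powForm_exact_succ hΩ ih
    obtain ⟨β, hβ, hβΩ⟩ := htop m (by omega)
    exact not_exists_extD_eq hm (fun p ↦ hne p (m + 1) le_rfl) ⟨β, hβ, hβΩ⟩

omit [FiniteDimensional ℝ E] [IsManifold 𝓘(ℝ, E) ∞ M] in
lemma powForm_one (Ω : DiffForm E M 2) : powForm Ω 1 = (2 : ℝ) • Ω := by
  funext p
  let τ : E [⋀^Fin 2]→L[ℝ] ℝ := Ω p
  let β : E [⋀^Fin 0]→L[ℝ] ℝ := ContinuousAlternatingMap.constOfIsEmpty ℝ E (Fin 0) (1 : ℝ)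
  change wedgeTwo β τ = (2 : ℝ) • τ
  ext v
  have hv : v = Matrix.vecCons (v 0) ![v 1] := by
    ext i
    fin_cases i <;> rfl
  rw [hv, ← contract_apply, contract_wedgeTwo_zero]
  have h1 := wedgeOne_apply_of_forall_eq_zero (curryTwo τ (v 0)) β (v 1) ![] fun j ↦ j.elim0
  rw [ContinuousAlternatingMap.smul_apply, h1, curryTwo_apply]
  simp [β]

omit [FiniteDimensional ℝ E] [IsManifold 𝓘(ℝ, E) ∞ M] in
lemma deRhamClass_ne_zero {k : ℕ} {α : DiffForm E M k} (hα : α ∈ closedForms E M k)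
    (h : α ∉ exactForms E M k) : deRhamClass α hα ≠ 0 := fun h0 ↦
  h (Submodule.mem_comap.1 ((Submodule.Quotient.mk_eq_zero
    ((exactForms E M k).submoduleOf (closedForms E M k))).1 h0))

end Cohomology

end SlantGeometry

end

theorem theorem5p3 {m n : ℕ}
    {N : Type*} [TopologicalSpace N] [T2Space N] [SecondCountableTopology N]
    [ChartedSpace (EuclideanSpace ℝ (Fin (2 * n + 1))) N] [IsManifold (𝓡 (2 * n + 1)) ∞ N]
    [RiemannianBundle (fun x : N ↦ TangentSpace (𝓡 (2 * n + 1)) x)]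
    [IsContMDiffRiemannianBundle (𝓡 (2 * n + 1)) ∞ (EuclideanSpace ℝ (Fin (2 * n + 1)))
      (fun x : N ↦ TangentSpace (𝓡 (2 * n + 1)) x)]
    (S : SlantGeometry.AlmostContactMetricStructure (EuclideanSpace ℝ (Fin (2 * n + 1))) N)
    (hS : S.IsCosymplectic)
    {M : Type*} [TopologicalSpace M] [T2Space M] [CompactSpace M] [Nonempty M]
    [ChartedSpace (EuclideanSpace ℝ (Fin (2 * m))) M] [IsManifold (𝓡 (2 * m)) ∞ M]
    (f : M → N)
    (hf : SlantGeometry.IsImmersedSubmanifold (E := EuclideanSpace ℝ (Fin (2 * n + 1)))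
      (E' := EuclideanSpace ℝ (Fin (2 * m))) f)
    (hslant : S.IsProperPointwiseSlant (E' := EuclideanSpace ℝ (Fin (2 * m))) f)
    (hξ : S.IsNormalTo (E' := EuclideanSpace ℝ (Fin (2 * m))) f) :
    (1 ≤ m → ∃ hΩ : S.slantForm f ∈ SlantGeometry.closedForms (EuclideanSpace ℝ (Fin (2 * m))) M 2,
      SlantGeometry.deRhamClass (S.slantForm f) hΩ ≠ 0) ∧
    ∀ i ≤ m, 1 ≤ Module.rank ℝ
      (SlantGeometry.DeRhamCohomology (EuclideanSpace ℝ (Fin (2 * m))) M (2 * i)) := by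
  have hΦ := S.isSmoothForm_fundamentalForm
  have hΩ : S.slantForm f ∈ SlantGeometry.closedForms (EuclideanSpace ℝ (Fin (2 * m))) M 2 := by
    rw [S.slantForm_eq_pullbackForm f]
    exact ⟨hΦ.pullbackForm hf.contMDiff,
      SlantGeometry.extD_pullbackForm_eq_zero hf.contMDiff hΦ hS.d_fundamentalForm⟩
  have hpow {i : ℕ} (hi : i ≤ m) := SlantGeometry.powForm_notMem_exactForms
    (E := EuclideanSpace ℝ (Fin (2 * m))) (by simp) hΩ
    (S.slantForm_nondegenerate f hf hslant hξ) hi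
  refine ⟨fun hm ↦ ⟨hΩ, SlantGeometry.deRhamClass_ne_zero hΩ fun h ↦ hpow hm ?_⟩, fun i hi ↦ ?_⟩
  · rw [SlantGeometry.powForm_one]
    exact Submodule.smul_mem _ _ h
  · rw [Cardinal.one_le_iff_pos, rank_pos_iff_exists_ne_zero]
    exact ⟨_, SlantGeometry.deRhamClass_ne_zero
      (SlantGeometry.powForm_mem_closedForms hΩ i) (hpow hi)⟩
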